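/- **Conventions.** Let $D=(V,\mathcal F)$, $V=\{v_1,\dots,v_n\}$, be a delta-matroid of rank $r=\max\{|F| : F\in\mathcal F\}$. For a skew-symmetric matrix $A$ (with zero diagonal) over a field, $\mathbf D(A)$ denotes the family of all index sets $S$ such that the principal submatrix $A[S]$ is nonsingular. A *sparse representation* of a linear delta-matroid $D$ is a matrix $$A=\begin{pmatrix} B & C\\ -C^{T} & 0\end{pmatrix}$$ with rows and columns indexed by $T\cup V$, where $B$ is skew-symmetric and indexed by $T$, such that $D=\mathbf D(A)/T$, i.e. $F\in\mathcal F$ iff $A[T\cup F]$ is nonsingular. A sparse representation of a projected linear delta-matroid $D$ is such a matrix indexed by $T\cup(Z\cup V)$, with zero block on $Z\cup V$, such that $D=(\mathbf D(A)/T)|Z$, i.e. $F\in\mathcal F$ iff $A[T\cup U\cup F]$ is nonsingular for some $U\subseteq Z$. In both cases it is required that $|T|\le r+1$ (this includes the usual normalization $|T|=r$, and also representations as elementary projections, $|Z|=1$, of delta-matroids of rank $|T|\in\{r,r+1\}$). Running times count the steps of one fixed program for a random-access machine with operations on field elements, black-box queries and random field elements at unit cost; $O^*(2^r)$ means $2^r$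 times a polynomial in $n+|T|+|Z|$. **Theorem.** Let $P(X)$, $X=\{x_1,\dots,x_n\}$, be a homogeneous polynomial of degree $k$ over a field $\mathbb F$ of characteristic 2, given as a black box that evaluates $P$ at points of $\mathbb F^n$, and let $D$ be as above, with representation over $\mathbb F$. Call a term $P(m)X^m$, $P(m)\neq 0$, of $P$ *feasible* if it is multilinear and $\{v_i : i\in\operatorname{supp}(m)\}\in\mathcal F$. 1. Let $D$ be a linear delta-matroid given by a sparse representation $\mathbf D(A)/T$, and put $$Q(X)=\sum_{m\ \text{multilinear}} P(m)\cdot \operatorname{Pf}A[T\cup V_m]\cdot X^m,\qquad V_m=\{v_i : i\in\operatorname{supp}(m)\}.$$ The monomials with non-zero coefficient in $Q$ are exactly those of the feasible terms of $P$, and there is a deterministic algorithm that, given the representation, $k$, a point $x\in\mathbb F^n$, and black-box access to $P$, computes $Q(x)$ in time $O^*(2^r)$. 2. Let $\mathbb F$ be finite with at least $3k$ elements, and let $D$ be a linear or projected linear delta-matroid given by a sparse representation. There is a randomized algorithm that, given the representation, $k$, and black-box access to $P$, decides in time $O^*(2^r)$ whether $P$ has a feasible term: if there is none it always answers "no", and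 if there is one it answers "yes" with probability at least $2/3$. -/

import Mathlib

open scoped Matrix

/-! ### Skew-symmetric matrices, Pfaffians and delta-matroids -/

/-- Skew-symmetric matrices; the diagonal is required to vanish (this matters in characteristic 2). -/
def IsSkew {ι R : Type*} [Ring R] (A : Matrix ι ι R) : Prop :=
  Aᵀ = -A ∧ ∀ i, A i i = 0

/-- The Pfaffian of a skew-symmetric matrix.  Perfect matchings of the index set are encoded as
fixed-point-free involutions `σ`; the sign of a matching is `-1` to the number of its crossings,
i.e. of pairs `i < j < σ i < σ j`. -/
def pfaffian {ι R : Type*} [Fintype ι] [LinearOrder ι] [CommRing R] (A : Matrix ι ι R) : R :=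
  ∑ σ : Equiv.Perm ι with ∀ i, σ (σ i) = i ∧ σ i ≠ i,
    (-1) ^ (Finset.univ.filter (fun q : ι × ι =>
        q.1 < q.2 ∧ q.2 < σ q.1 ∧ σ q.1 < σ q.2)).card *
      ∏ i with i < σ i, A i (σ i)

/-- The Pfaffian `Pf A[S]` of a principal submatrix of a matrix indexed by a disjoint union
`α ⊕ β`, whose elements are ordered with `α` before `β`. -/
def pfaffianOn {α β R : Type*} [LinearOrder α] [LinearOrder β] [CommRing R]
    (A : Matrix (α ⊕ β) (α ⊕ β) R) (S : Finset (α ⊕ β)) : R :=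
  letI : Fintype {i : α ⊕ₗ β // ofLex i ∈ S} :=
    Fintype.ofEquiv {i : α ⊕ β // i ∈ S}
      (toLex.subtypeEquiv (fun _ => Iff.rfl))
  pfaffian (A.submatrix (fun i : {i : α ⊕ₗ β // ofLex i ∈ S} => ofLex i.1)
    (fun i : {i : α ⊕ₗ β // ofLex i ∈ S} => ofLex i.1))

/-- A delta-matroid: a collection of feasible sets with the symmetric exchange axiom. -/
structure DeltaMatroid (V : Type*) [DecidableEq V] where
  /-- the collection of feasible sets -/
  Feasible : Set (Finset V)
  /-- the symmetric exchange axiom -/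
  exchange : ∀ A ∈ Feasible, ∀ B ∈ Feasible, ∀ x ∈ symmDiff A B,
    ∃ y ∈ symmDiff A B, symmDiff A {x, y} ∈ Feasible

/-- The rank of a delta-matroid: the maximum cardinality of a feasible set. -/
noncomputable def DeltaMatroid.rank {V : Type*} [DecidableEq V] (D : DeltaMatroid V) : ℕ :=
  sSup {c | ∃ S ∈ D.Feasible, S.card = c}

/-- The feasible sets of `𝐃(A)`: the index sets of the nonsingular principal submatrices. -/
def nonsingularSets {ι F : Type*} [DecidableEq ι] [Field F] (A : Matrix ι ι F) :
    Set (Finset ι) :=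
  {S | (A.submatrix (fun i : {i // i ∈ S} => i.1) (fun i : {i // i ∈ S} => i.1)).det ≠ 0}

/-- The contraction of a set system on `α ⊕ β` by (all of) `α`. -/
def contractFst {α β : Type*} [Fintype α] (𝓕 : Set (Finset (α ⊕ β))) : Set (Finset β) :=
  {S | Finset.univ.disjSum S ∈ 𝓕}

/-- The projection of a set system on `α ⊕ β` to `β`. -/
def projectFst {α β : Type*} (𝓕 : Set (Finset (α ⊕ β))) : Set (Finset β) :=
  {S | ∃ U : Finset α, U.disjSum S ∈ 𝓕}

/-- The matrix `[[B, C], [-Cᵀ, 0]]` of a sparse contraction representation. -/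
def sparseMatrix {T W F : Type*} [Field F] (B : Matrix T T F) (C : Matrix T W F) :
    Matrix (T ⊕ W) (T ⊕ W) F :=
  Matrix.fromBlocks B C (-Cᵀ) 0

/-- `D = 𝐃(A) / T` with the sparse matrix `A = [[B, C], [-Cᵀ, 0]]`. -/
def IsSparseRep {T V F : Type*} [Fintype T] [DecidableEq T] [DecidableEq V] [Field F]
    (D : DeltaMatroid V) (B : Matrix T T F) (C : Matrix T V F) : Prop :=
  IsSkew B ∧ D.Feasible = contractFst (nonsingularSets (sparseMatrix B C))

/-- `D = (𝐃(A) / T) | Z`, the projection to `V` of the linear delta-matroid on `Z ⊕ V` with the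
sparse representation given by `B` and `[E, C]`. -/
def IsProjectedSparseRep {T Z V F : Type*} [Fintype T] [DecidableEq T] [DecidableEq Z]
    [DecidableEq V] [Field F]
    (D : DeltaMatroid V) (B : Matrix T T F) (E : Matrix T Z F) (C : Matrix T V F) : Prop :=
  IsSkew B ∧ D.Feasible =
    projectFst (contractFst (nonsingularSets (sparseMatrix B (Matrix.fromCols E C))))

/-! ### The terms to be sieved for -/

/-- `m` is (the exponent vector of) a term of `P` that is multilinear and has a support that is
feasible in `D`. -/
def IsFeasibleTerm {V F : Type*} [DecidableEq V] [Field F] (D : DeltaMatroid V)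
    (P : MvPolynomial V F) (m : V →₀ ℕ) : Prop :=
  P.coeff m ≠ 0 ∧ (∀ i, m i ≤ 1) ∧ m.support ∈ D.Feasible

/-- The sieved polynomial `∑ P(m) · Pf A[T ∪ supp m] · X ^ m`, where `m` ranges over the multilinear
monomials of `P` and `A = [[B, C], [-Cᵀ, 0]]`. -/
noncomputable def sievedPolynomial {T V F : Type*} [Fintype T] [Fintype V] [LinearOrder T]
    [LinearOrder V] [Field F] (B : Matrix T T F) (C : Matrix T V F) (P : MvPolynomial V F) :
    MvPolynomial V F :=
  ∑ m ∈ P.support with ∀ i, m i ≤ 1,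
    MvPolynomial.monomial m
      (P.coeff m * pfaffianOn (sparseMatrix B C) (Finset.univ.disjSum m.support))

/-! ### The machine model

A random-access machine with integer cells and cells for elements of a field `F`, programmed in a
small imperative language.  On integers it can only form constants, successors and predecessors
and compare, so that after `s` steps every integer is at most the largest input plus `O(s)`.  On
field elements it has the field operations and a zero test.  It has access to a black box and to
uniformly random field elements.  A program is a finite text that does not mention the field or the
input size: one and the same program is run on all inputs. -/

/-- Integer expressions: constants, successor, (truncated) predecessor, and the content of cell
number `i` of the integer array `a`. -/
inductive IExp where
  | lit (c : ℕ)
  | succ (e : IExp)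
  | pred (e : IExp)
  | get (a : ℕ) (i : IExp)

/-- Field expressions; `get a i j` is the content of cell `(i, j)` of the two-dimensional field
array `a`, and `inv` is the inverse, with `inv 0 = 0`. -/
inductive FExp where
  | zero
  | one
  | add (e f : FExp)
  | neg (e : FExp)
  | mul (e f : FExp)
  | inv (e : FExp)
  | get (a : ℕ) (i j : IExp)

/-- Tests. -/
inductive Test where
  | lt (e f : IExp)
  | isZero (e : FExp)
  | not (b : Test)
  | and (b c : Test)

/-- Programs. -/
inductive Prog where
  /-- do nothing -/
  | nop
  /-- integer assignment `a[i] := e` -/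
  | setI (a : ℕ) (i e : IExp)
  /-- field assignment `a[i, j] := e` -/
  | setF (a : ℕ) (i j : IExp) (e : FExp)
  /-- `a[i, j] := ` a fresh uniformly random field element -/
  | rand (a : ℕ) (i j : IExp)
  /-- `a[i, j] := ` the answer of the black box at the point stored in row `l` of array `b` -/
  | query (a : ℕ) (i j : IExp) (b : ℕ) (l : IExp)
  /-- sequential composition -/
  | seq (p q : Prog)
  /-- `if b then p else q` -/
  | cond (b : Test) (p q : Prog)
  /-- `while b do p` -/
  | loop (b : Test) (p : Prog)

/-- The memory: integer arrays, two-dimensional field arrays, and the part of the random tape that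
has not been read. -/
structure Store (F : Type*) where
  int : ℕ → ℕ → ℕ
  fld : ℕ → ℕ → ℕ → F
  tape : ℕ → F

namespace Store

variable {F : Type*}

/-- Write `v` into cell `i` of the integer array `a`. -/
def setI (s : Store F) (a i v : ℕ) : Store F :=
  { s with int := Function.update s.int a (Function.update (s.int a) i v) }

/-- Write `v` into cell `(i, j)` of the field array `a`. -/
def setF (s : Store F) (a i j : ℕ) (v : F) : Store F :=
  let row := Function.update (s.fld a i) j v
  { s with fld := Function.update s.fld a (Function.update (s.fld a) i row) }

/-- Move to the next cell of the random tape. -/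
def advance (s : Store F) : Store F :=
  { s with tape := fun i => s.tape (i + 1) }

end Store

/-- The value of an integer expression. -/
def IExp.eval {F : Type*} (s : Store F) : IExp → ℕ
  | .lit c => c
  | .succ e => e.eval s + 1
  | .pred e => e.eval s - 1
  | .get a i => s.int a (i.eval s)

/-- The value of a field expression. -/
def FExp.eval {F : Type*} [Field F] (s : Store F) : FExp → F
  | .zero => 0
  | .one => 1
  | .add e f => e.eval s + f.eval s
  | .neg e => -e.eval s
  | .mul e f => e.eval s * f.eval s
  | .inv e => (e.eval s)⁻¹
  | .get a i j => s.fld a (i.eval s) (j.eval s)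

/-- The truth value of a test. -/
def Test.Holds {F : Type*} [Field F] (s : Store F) : Test → Prop
  | .lt e f => e.eval s < f.eval s
  | .isZero e => e.eval s = 0
  | .not b => ¬ b.Holds s
  | .and b c => b.Holds s ∧ c.Holds s

/-- `Exec o p s c s'`: the program `p`, with black box `o` and started in the store `s`, halts in
the store `s'` after exactly `c` steps.  Each assignment, each black-box query, each draw of a random
element and each evaluation of a test is one step (expressions have constant size). -/
inductive Exec {F : Type*} [Field F] (o : (ℕ → F) → F) :
    Prog → Store F → ℕ → Store F → Prop
  | nop (s : Store F) : Exec o .nop s 1 s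
  | setI (s : Store F) (a : ℕ) (i e : IExp) :
      Exec o (.setI a i e) s 1 (s.setI a (i.eval s) (e.eval s))
  | setF (s : Store F) (a : ℕ) (i j : IExp) (e : FExp) :
      Exec o (.setF a i j e) s 1 (s.setF a (i.eval s) (j.eval s) (e.eval s))
  | rand (s : Store F) (a : ℕ) (i j : IExp) :
      Exec o (.rand a i j) s 1 ((s.setF a (i.eval s) (j.eval s) (s.tape 0)).advance)
  | query (s : Store F) (a : ℕ) (i j : IExp) (b : ℕ) (l : IExp) :
      Exec o (.query a i j b l) s 1
        (s.setF a (i.eval s) (j.eval s) (o (s.fld b (l.eval s))))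
  | seq {p q : Prog} {s s₁ s₂ : Store F} {c d : ℕ} :
      Exec o p s c s₁ → Exec o q s₁ d s₂ → Exec o (.seq p q) s (c + d) s₂
  | cond_true {b : Test} {p q : Prog} {s s₁ : Store F} {c : ℕ} :
      b.Holds s → Exec o p s c s₁ → Exec o (.cond b p q) s (1 + c) s₁
  | cond_false {b : Test} {p q : Prog} {s s₁ : Store F} {c : ℕ} :
      ¬ b.Holds s → Exec o q s c s₁ → Exec o (.cond b p q) s (1 + c) s₁
  | loop_true {b : Test} {p : Prog} {s s₁ s₂ : Store F} {c d : ℕ} :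
      b.Holds s → Exec o p s c s₁ → Exec o (.loop b p) s₁ d s₂ →
        Exec o (.loop b p) s (1 + c + d) s₂
  | loop_false {b : Test} {p : Prog} {s : Store F} :
      ¬ b.Holds s → Exec o (.loop b p) s 1 s

/-- Execution is deterministic (for a fixed random tape): final store and step count are unique. -/
theorem Exec.deterministic {F : Type*} [Field F] {o : (ℕ → F) → F} {p : Prog} {s s₁ s₂ : Store F}
    {c d : ℕ} (h₁ : Exec o p s c s₁) (h₂ : Exec o p s d s₂) : c = d ∧ s₁ = s₂ := by
  induction h₁ generalizing d s₂ with
  | nop | setI | setF | rand | query => cases h₂; exact ⟨rfl, rfl⟩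
  | seq _ _ ih₁ ih₂ =>
    cases h₂ with
    | seq h h' =>
      obtain ⟨rfl, rfl⟩ := ih₁ h
      obtain ⟨rfl, rfl⟩ := ih₂ h'
      exact ⟨rfl, rfl⟩
  | cond_true hb _ ih =>
    cases h₂ with
    | cond_true _ h => obtain ⟨rfl, rfl⟩ := ih h; exact ⟨rfl, rfl⟩
    | cond_false hn _ => exact absurd hb hn
  | cond_false hb _ ih =>
    cases h₂ with
    | cond_true hn _ => exact absurd hn hb
    | cond_false _ h => obtain ⟨rfl, rfl⟩ := ih h; exact ⟨rfl, rfl⟩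
  | loop_true hb _ _ ih₁ ih₂ =>
    cases h₂ with
    | loop_true _ h h' =>
      obtain ⟨rfl, rfl⟩ := ih₁ h
      obtain ⟨rfl, rfl⟩ := ih₂ h'
      exact ⟨rfl, rfl⟩
    | loop_false hn => exact absurd hb hn
  | loop_false hb =>
    cases h₂ with
    | loop_true hn _ _ => exact absurd hn hb
    | loop_false _ => exact ⟨rfl, rfl⟩

/-- Black-box access to `P`: the first `n` entries of the queried row are substituted for the
variables. -/
noncomputable def blackBox {n : ℕ} {F : Type*} [Field F] (P : MvPolynomial (Fin n) F) :
    (ℕ → F) → F :=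
  fun v => MvPolynomial.eval (fun i : Fin n => v i) P

/-- A matrix as the content of a field array (padded with zeros). -/
def matrixArray {a b : ℕ} {F : Type*} [Field F] (M : Matrix (Fin a) (Fin b) F) : ℕ → ℕ → F :=
  fun i j => if h : i < a ∧ j < b then M ⟨i, h.1⟩ ⟨j, h.2⟩ else 0

/-- The initial store.  Integer array `0` holds `n, t, p, k`; the field arrays `0, 1, 2` hold the
blocks `B`, `E`, `C` of the representation, and row `0` of field array `3` holds the point `x`.
All other cells are zero. -/
def inputStore {n t p : ℕ} {F : Type*} [Field F] (k : ℕ) (B : Matrix (Fin t) (Fin t) F)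
    (E : Matrix (Fin t) (Fin p) F) (C : Matrix (Fin t) (Fin n) F) (x : Fin n → F)
    (tape : ℕ → F) : Store F where
  int
    | 0, 0 => n
    | 0, 1 => t
    | 0, 2 => p
    | 0, 3 => k
    | _, _ => 0
  fld
    | 0 => matrixArray B
    | 1 => matrixArray E
    | 2 => matrixArray C
    | 3 => matrixArray (Matrix.of (fun (_ : Fin 1) => x))
    | _ => 0
  tape := tape

/-- `p` halts within `N` steps in a store that satisfies `R`. -/
def HaltsWithin {F : Type*} [Field F] (o : (ℕ → F) → F) (p : Prog) (s : Store F) (N : ℕ)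
    (R : Store F → Prop) : Prop :=
  ∃ c ≤ N, ∃ s', Exec o p s c s' ∧ R s'

/-- A field output is found in cell `(0, 0)` of field array `0`. -/
def Store.outF {F : Type*} (s : Store F) : F := s.fld 0 0 0

/-- A yes/no output is found in cell `0` of integer array `0`: yes is `1`, no is `0`. -/
def Store.outI {F : Type*} (s : Store F) : ℕ := s.int 0 0

/-- A finite random tape (padded with zeros). -/
def padTape {N : ℕ} {F : Type*} [Field F] (w : Fin N → F) : ℕ → F :=
  fun i => if h : i < N then w ⟨i, h⟩ else 0

/-- The probability that a program answers yes within `N` steps.  The random tape consists of `N`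
independent uniformly random field elements (no more can be read in `N` steps). -/
noncomputable def yesProb {F : Type*} [Field F] (o : (ℕ → F) → F) (p : Prog)
    (s : (ℕ → F) → Store F) (N : ℕ) : ℝ :=
  (Nat.card {w : Fin N → F // HaltsWithin o p (s (padTape w)) N (fun s' => s'.outI = 1)} : ℝ) /
    (Nat.card (Fin N → F) : ℝ)

/-- `poly(n, t, p) · 2 ^ r`. -/
def timeBound (c n t p r : ℕ) : ℕ := c * (n + t + p + 1) ^ c * 2 ^ r

/-!
The sieved polynomial is evaluated without ever computing a Pfaffian.  Let `u` run over the
characteristic vectors of the subsets of `T`, and consider, for a homogeneous `P` of degree `k`,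
`S(x, z) = ∑ u, P(x i * ∑ a, C a i * u a) * [ζ ^ t] ζ ^ k * (∏ j, (1 + ζ * z j * ∑ a, E a j * u a)) *
  ∏ (a < b), (1 + ζ ^ 2 * B a b * u a * u b)`.
Every summand is the value at `u` of a form of degree `t = |T|` in the entries of `u`, and in
characteristic `2` the sum over all `u` retains exactly the terms in which all `t` variables occur
(`sum_superset`).  A linear form that is squared loses a degree, since squaring is additive and the
`u a` are idempotent; this removes the terms of `P` that are not multilinear
(`linear_pow_mem_degreeLE`).  For a multilinear term `m` and a set `J` of projected elements, what
is left is the sum over the perfect matchings of `T ∪ J ∪ supp m` without edges inside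
`J ∪ supp m` (`coverSum_eq_sum`), and as the block of the sparse matrix on these elements vanishes,
this is its Pfaffian (`pfaffian_eq_coverSum`).  Hence
`S(x, z) = ∑ m J, P(m) * Pf A[T ∪ J ∪ m] * x ^ m * z ^ J`
(`sum_eval_mul_edgeSum`, `partialSum_eq`).  A summand of `S` takes polynomial time, and there are
`2 ^ t` of them.  Nonsingularity is detected by the Pfaffian because `Pf ^ 2 = det`
(`pfaffian_sq`): in characteristic `2` the permutations in the determinant that are not involutions
cancel against their inverses.

For the decision problem, `x` is a random point.  The field is too small to substitute random
elements for the variables `z` as well: the bound `3 k ≤ |F|` leaves room only for the degree in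
`x`.  Instead `z j` is a random polynomial of degree less than `p + 3` in a new variable, so that
`S` takes values in `F[X]`, and the Schwartz-Zippel lemma over this domain bounds the probability
of an error by `k / q + p / q ^ (p + 3)` (`card_zeros_le`).  This is at most `1 / 3`, because `q`,
a power of `2`, is different from `3 k` (`error_le`).

The programs are verified with rules for halting within a number of steps; that a program changes
only what it mentions as a target of a write is a syntactic fact (`Exec.unchanged`).
-/

/-! ### Reasoning about programs -/

section ProgramLogic

/-- The integer arrays that a program may write to. -/
def Prog.intWrites : Prog → List ℕ
  | .setI a _ _ => [a]
  | .seq p q => p.intWrites ++ q.intWrites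
  | .cond _ p q => p.intWrites ++ q.intWrites
  | .loop _ p => p.intWrites
  | _ => []

/-- The field arrays that a program may write to. -/
def Prog.fldWrites : Prog → List ℕ
  | .setF a _ _ _ => [a]
  | .rand a _ _ => [a]
  | .query a _ _ _ _ => [a]
  | .seq p q => p.fldWrites ++ q.fldWrites
  | .cond _ p q => p.fldWrites ++ q.fldWrites
  | .loop _ p => p.fldWrites
  | _ => []

/-- Whether a program may read the random tape. -/
def Prog.draws : Prog → Bool
  | .rand _ _ _ => true
  | .seq p q => p.draws || q.draws
  | .cond _ p q => p.draws || q.draws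
  | .loop _ p => p.draws
  | _ => false

variable {F : Type*}

@[simp] theorem Store.setI_int_self (s : Store F) (a i v : ℕ) : (s.setI a i v).int a i = v := by
  simp [Store.setI]

theorem Store.setI_int_ne (s : Store F) {a b : ℕ} (h : b ≠ a) (i v : ℕ) :
    (s.setI a i v).int b = s.int b := by
  simp [Store.setI, h]

@[simp] theorem Store.setI_fld (s : Store F) (a i v : ℕ) : (s.setI a i v).fld = s.fld := rfl

@[simp] theorem Store.setI_tape (s : Store F) (a i v : ℕ) : (s.setI a i v).tape = s.tape := rfl

@[simp] theorem Store.setF_int (s : Store F) (a i j : ℕ) (v : F) :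
    (s.setF a i j v).int = s.int := rfl

@[simp] theorem Store.setF_tape (s : Store F) (a i j : ℕ) (v : F) :
    (s.setF a i j v).tape = s.tape := rfl

theorem Store.setF_fld_self (s : Store F) (a i j : ℕ) (v : F) :
    (s.setF a i j v).fld a = Function.update (s.fld a) i (Function.update (s.fld a i) j v) := by
  simp [Store.setF]

theorem Store.setF_fld_ne (s : Store F) {a b : ℕ} (h : b ≠ a) (i j : ℕ) (v : F) :
    (s.setF a i j v).fld b = s.fld b := by
  simp [Store.setF, h]

/-- The stores `s` and `s'` agree in everything that the text of `p` does not mention as a target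
of a write. -/
structure Unchanged (p : Prog) (s s' : Store F) : Prop where
  int : ∀ a, a ∉ p.intWrites → s'.int a = s.int a
  fld : ∀ a, a ∉ p.fldWrites → s'.fld a = s.fld a
  tape : p.draws = false → s'.tape = s.tape

theorem Unchanged.refl (p : Prog) (s : Store F) : Unchanged p s s :=
  ⟨fun _ _ => rfl, fun _ _ => rfl, fun _ => rfl⟩

theorem Unchanged.trans {p : Prog} {s s' s'' : Store F} (h : Unchanged p s s')
    (h' : Unchanged p s' s'') : Unchanged p s s'' :=
  ⟨fun a ha => (h'.int a ha).trans (h.int a ha), fun a ha => (h'.fld a ha).trans (h.fld a ha),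
    fun ht => (h'.tape ht).trans (h.tape ht)⟩

theorem Unchanged.mono {p q : Prog} {s s' : Store F} (h : Unchanged p s s')
    (hi : p.intWrites ⊆ q.intWrites) (hf : p.fldWrites ⊆ q.fldWrites)
    (ht : q.draws = false → p.draws = false) : Unchanged q s s' :=
  ⟨fun a ha => h.int a (fun h' => ha (hi h')), fun a ha => h.fld a (fun h' => ha (hf h')),
    fun h' => h.tape (ht h')⟩

theorem Exec.unchanged [Field F] {o : (ℕ → F) → F} {p : Prog} {s s' : Store F} {c : ℕ}
    (h : Exec o p s c s') : Unchanged p s s' := by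
  induction h with
  | nop s => exact Unchanged.refl _ _
  | setI s a i e =>
    refine ⟨fun b hb => ?_, fun _ _ => rfl, fun _ => rfl⟩
    have : b ≠ a := by simpa [Prog.intWrites] using hb
    simp [Store.setI, this]
  | setF s a i j e =>
    refine ⟨fun _ _ => rfl, fun b hb => ?_, fun _ => rfl⟩
    have : b ≠ a := by simpa [Prog.fldWrites] using hb
    simp [Store.setF, this]
  | rand s a i j =>
    refine ⟨fun _ _ => rfl, fun b hb => ?_, fun h => by simp [Prog.draws] at h⟩
    have : b ≠ a := by simpa [Prog.fldWrites] using hb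
    simp [Store.setF, Store.advance, this]
  | query s a i j b l =>
    refine ⟨fun _ _ => rfl, fun b hb => ?_, fun _ => rfl⟩
    have : b ≠ a := by simpa [Prog.fldWrites] using hb
    simp [Store.setF, this]
  | seq _ _ ih₁ ih₂ =>
    exact (ih₁.mono (by simp [Prog.intWrites]) (by simp [Prog.fldWrites])
      (by simp +contextual [Prog.draws])).trans
      (ih₂.mono (by simp [Prog.intWrites]) (by simp [Prog.fldWrites])
      (by simp +contextual [Prog.draws]))
  | cond_true _ _ ih =>
    exact ih.mono (by simp [Prog.intWrites]) (by simp [Prog.fldWrites])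
      (by simp +contextual [Prog.draws])
  | cond_false _ _ ih =>
    exact ih.mono (by simp [Prog.intWrites]) (by simp [Prog.fldWrites])
      (by simp +contextual [Prog.draws])
  | loop_true _ _ _ ih₁ ih₂ =>
    exact (ih₁.mono (by simp [Prog.intWrites]) (by simp [Prog.fldWrites])
      (by simp +contextual [Prog.draws])).trans ih₂
  | loop_false _ => exact Unchanged.refl _ _

variable [Field F] {o : (ℕ → F) → F}

theorem HaltsWithin.mono {p : Prog} {s : Store F} {N N' : ℕ} {R R' : Store F → Prop}
    (h : HaltsWithin o p s N R) (hN : N ≤ N') (hR : ∀ s', R s' → R' s') :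
    HaltsWithin o p s N' R' := by
  obtain ⟨c, hc, s', he, hr⟩ := h
  exact ⟨c, hc.trans hN, s', he, hR s' hr⟩

/-- A halting program may be assumed to change only what it writes to. -/
theorem HaltsWithin.mono' {p : Prog} {s : Store F} {N N' : ℕ} {R R' : Store F → Prop}
    (h : HaltsWithin o p s N R) (hN : N ≤ N') (hR : ∀ s', Unchanged p s s' → R s' → R' s') :
    HaltsWithin o p s N' R' := by
  obtain ⟨c, hc, s', he, hr⟩ := h
  exact ⟨c, hc.trans hN, s', he, hR s' he.unchanged hr⟩

theorem HaltsWithin.nop {s : Store F} {R : Store F → Prop} (h : R s) :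
    HaltsWithin o .nop s 1 R :=
  ⟨1, le_rfl, s, .nop s, h⟩

theorem HaltsWithin.setI {s : Store F} {R : Store F → Prop} {a : ℕ} {i e : IExp}
    (h : R (s.setI a (i.eval s) (e.eval s))) : HaltsWithin o (.setI a i e) s 1 R :=
  ⟨1, le_rfl, _, .setI s a i e, h⟩

theorem HaltsWithin.setF {s : Store F} {R : Store F → Prop} {a : ℕ} {i j : IExp} {e : FExp}
    (h : R (s.setF a (i.eval s) (j.eval s) (e.eval s))) : HaltsWithin o (.setF a i j e) s 1 R :=
  ⟨1, le_rfl, _, .setF s a i j e, h⟩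

theorem HaltsWithin.rand {s : Store F} {R : Store F → Prop} {a : ℕ} {i j : IExp}
    (h : R ((s.setF a (i.eval s) (j.eval s) (s.tape 0)).advance)) :
    HaltsWithin o (.rand a i j) s 1 R :=
  ⟨1, le_rfl, _, .rand s a i j, h⟩

theorem HaltsWithin.query {s : Store F} {R : Store F → Prop} {a b : ℕ} {i j l : IExp}
    (h : R (s.setF a (i.eval s) (j.eval s) (o (s.fld b (l.eval s))))) :
    HaltsWithin o (.query a i j b l) s 1 R :=
  ⟨1, le_rfl, _, .query s a i j b l, h⟩

theorem HaltsWithin.seq {p q : Prog} {s : Store F} {N₁ N₂ : ℕ} {R₁ R : Store F → Prop}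
    (h₁ : HaltsWithin o p s N₁ R₁)
    (h₂ : ∀ s', Unchanged p s s' → R₁ s' → HaltsWithin o q s' N₂ R) :
    HaltsWithin o (.seq p q) s (N₁ + N₂) R := by
  obtain ⟨c, hc, s₁, he, hr⟩ := h₁
  obtain ⟨d, hd, s₂, he', hr'⟩ := h₂ s₁ he.unchanged hr
  exact ⟨c + d, by omega, s₂, .seq he he', hr'⟩

theorem HaltsWithin.cond {b : Test} {p q : Prog} {s : Store F} {N : ℕ} {R : Store F → Prop}
    (h₁ : b.Holds s → HaltsWithin o p s N R) (h₂ : ¬ b.Holds s → HaltsWithin o q s N R) :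
    HaltsWithin o (.cond b p q) s (1 + N) R := by
  by_cases hb : b.Holds s
  · obtain ⟨c, hc, s₁, he, hr⟩ := h₁ hb
    exact ⟨1 + c, by omega, s₁, .cond_true hb he, hr⟩
  · obtain ⟨c, hc, s₁, he, hr⟩ := h₂ hb
    exact ⟨1 + c, by omega, s₁, .cond_false hb he, hr⟩

/-- A loop that is known to make exactly `M` passes. -/
theorem HaltsWithin.loop {b : Test} {p : Prog} {s : Store F} {M K : ℕ} {Inv : ℕ → Store F → Prop}
    (h0 : Inv 0 s)
    (hstep : ∀ i < M, ∀ s', Unchanged (.loop b p) s s' → Inv i s' →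
      b.Holds s' ∧ HaltsWithin o p s' K (Inv (i + 1)))
    (hend : ∀ s', Unchanged (.loop b p) s s' → Inv M s' → ¬ b.Holds s') :
    HaltsWithin o (.loop b p) s (M * (K + 1) + 1) (Inv M) := by
  suffices H : ∀ d i s', i + d = M → Unchanged (.loop b p) s s' → Inv i s' →
      HaltsWithin o (.loop b p) s' (d * (K + 1) + 1) (Inv M) from
    H M 0 s (by omega) (Unchanged.refl _ _) h0
  intro d
  induction d with
  | zero =>
    intro i s' hi hu hI
    obtain rfl : i = M := by omega
    exact ⟨1, by omega, s', .loop_false (hend s' hu hI), hI⟩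
  | succ d ih =>
    intro i s' hi hu hI
    obtain ⟨hb, c, hc, s₁, he, hr⟩ := hstep i (by omega) s' hu hI
    have hu₁ : Unchanged (.loop b p) s s₁ := hu.trans (he.unchanged.mono (fun _ h => h)
      (fun _ h => h) (fun h => h))
    obtain ⟨e, hle, s₂, he', hr'⟩ := ih (i + 1) s₁ (by omega) hu₁ hr
    exact ⟨1 + c + e, by rw [Nat.succ_mul]; omega, s₂, .loop_true hb he he', hr'⟩

/-- The scalar variable kept in cell `0` of the integer array `a`. -/
abbrev IExp.var (a : ℕ) : IExp := .get a (.lit 0)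

/-- `for v = 0, …, b - 1 do p`, with the counter in cell `0` of the integer array `v`. -/
def Prog.forTo (v : ℕ) (b : IExp) (p : Prog) : Prog :=
  .seq (.setI v (.lit 0) (.lit 0))
    (.loop (.lt (.var v) b) (.seq p (.setI v (.lit 0) (.succ (.var v)))))

theorem HaltsWithin.forTo {v : ℕ} {b : IExp} {p : Prog} {s : Store F} {M K : ℕ}
    (Inv : ℕ → Store F → Prop) (hv : v ∉ p.intWrites)
    (hb : ∀ s', Unchanged (.forTo v b p) s s' → b.eval s' = M)
    (h0 : Inv 0 (s.setI v 0 0))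
    (hstep : ∀ i < M, ∀ s', Unchanged (.forTo v b p) s s' → s'.int v 0 = i → Inv i s' →
      HaltsWithin o p s' K (fun s'' => Inv (i + 1) (s''.setI v 0 (i + 1)))) :
    HaltsWithin o (.forTo v b p) s (M * (K + 2) + 2) (Inv M) := by
  have hsub : ∀ {s' : Store F}, Unchanged (.loop (.lt (.var v) b)
      (.seq p (.setI v (.lit 0) (.succ (.var v))))) (s.setI v 0 0) s' →
      Unchanged (.forTo v b p) s s' := by
    intro s' h
    have h1 : Unchanged (.forTo v b p) s (s.setI v 0 0) :=
      (Exec.setI (o := o) s v (.lit 0) (.lit 0)).unchanged.mono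
        (by simp [Prog.forTo, Prog.intWrites]) (by simp [Prog.fldWrites])
        (by simp [Prog.draws])
    exact h1.trans (h.mono (by simp [Prog.forTo, Prog.intWrites])
      (by simp [Prog.forTo, Prog.fldWrites]) (by simp [Prog.forTo, Prog.draws]))
  have hloop := HaltsWithin.loop (o := o) (b := .lt (.var v) b)
    (p := .seq p (.setI v (.lit 0) (.succ (.var v)))) (s := s.setI v 0 0) (M := M) (K := K + 1)
    (Inv := fun i s' => s'.int v 0 = i ∧ Inv i s') ⟨by simp, h0⟩
    (by
      rintro i hi s' hu ⟨hs, hI⟩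
      refine ⟨?_, ?_⟩
      · simp only [Test.Holds, IExp.eval, hs, hb s' (hsub hu)]
        exact hi
      · refine (hstep i hi s' (hsub hu) hs hI).seq ?_
        intro s'' hu' hI'
        refine HaltsWithin.setI ?_
        have : s''.int v 0 = i := by rw [hu'.int v hv, hs]
        simp only [IExp.eval, this]
        exact ⟨by simp, hI'⟩)
    (by
      rintro s' hu ⟨hs, -⟩
      simp only [Test.Holds, IExp.eval, hs, hb s' (hsub hu)]
      exact lt_irrefl _)
  have h1 : HaltsWithin o (.setI v (.lit 0) (.lit 0)) s 1 (fun s' => s' = s.setI v 0 0) :=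
    HaltsWithin.setI rfl
  refine (h1.seq (N₂ := M * (K + 1 + 1) + 1) (R := Inv M) ?_).mono (by ring_nf; omega) (fun _ h => h)
  rintro s' - rfl
  exact hloop.mono le_rfl (fun _ h => h.2)

end ProgramLogic

/-! ### The programs

Memory layout.  The loop counters and other integer variables are cell `0` of the integer arrays
`3` to `8`; cell `0` of array `1` holds the number `W` of coefficients that are kept of a
polynomial, and cell `0` of array `2` the number of digits of a random polynomial.  The field
arrays besides those of the input are: `4`, whose row `j` holds the digits of `z j`; `5`, the vector
`u`; `6`, the point for the black box; `7`, whose row `l` holds the coefficients of a polynomial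
`g l`; `8`, the accumulated sum; `9`, the answer of the black box; `10`, the carry; `11` and `12`,
scalars.

The factors of a summand multiply a polynomial in `ζ` whose coefficient at `ζ ^ (t - l)` is `g l`.
With this reversed indexing, multiplication by `1 + a * ζ ^ e` adds `a * g (l + e)` to `g l`, which
can be done in place for increasing `l`, and the coefficient in question is found in row `k` without
a subtraction; for `k > t` that row is zero, as it should be. -/

/-- `d[i, off + w] += c * b[l, w]` for all `w` below the number in `int 1`. -/
def Prog.addRow (d : ℕ) (i off : IExp) (c : FExp) (b : ℕ) (l : IExp) : Prog :=
  .seq (.setI 8 (.lit 0) off) (.forTo 7 (.var 1)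
    (.seq (.setF d i (.var 8) (.add (.get d i (.var 8)) (.mul c (.get b l (.var 7)))))
      (.setI 8 (.lit 0) (.succ (.var 8)))))

/-- Stores in row `0` of array `6` the point with coordinates `x i * ∑ j, C j i * u j`. -/
def Prog.point : Prog :=
  .forTo 3 (.get 0 (.lit 0)) (.seq (.setF 6 (.lit 0) (.var 3) .zero)
    (.forTo 4 (.get 0 (.lit 1)) (.setF 6 (.lit 0) (.var 3) (.add (.get 6 (.lit 0) (.var 3))
      (.mul (.mul (.get 2 (.var 4) (.var 3)) (.get 5 (.lit 0) (.var 4)))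
        (.get 3 (.lit 0) (.var 3)))))))

/-- Initializes array `7` to the polynomial `1`. -/
def Prog.clear : Prog :=
  .seq (.forTo 5 (.succ (.get 0 (.lit 1))) (.forTo 7 (.var 1) (.setF 7 (.var 5) (.var 7) .zero)))
    (.setF 7 (.get 0 (.lit 1)) (.lit 0) .one)

/-- Multiplies the polynomial in array `7` by the linear factor of a projected element. -/
def Prog.linearFactor : Prog :=
  .seq (.setF 11 (.lit 0) (.lit 0) .zero)
    (.seq (.forTo 3 (.get 0 (.lit 1)) (.setF 11 (.lit 0) (.lit 0)
        (.add (.get 11 (.lit 0) (.lit 0))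
          (.mul (.get 1 (.var 3) (.var 4)) (.get 5 (.lit 0) (.var 3))))))
      (.forTo 5 (.get 0 (.lit 1)) (.forTo 6 (.var 2)
        (.addRow 7 (.var 5) (.var 6)
          (.mul (.get 11 (.lit 0) (.lit 0)) (.get 4 (.var 4) (.var 6))) 7 (.succ (.var 5))))))

/-- Multiplies the polynomial in array `7` by the quadratic factor of an entry of `B`. -/
def Prog.quadraticFactor : Prog :=
  .forTo 5 (.get 0 (.lit 1)) (.addRow 7 (.var 5) (.lit 0)
    (.mul (.get 0 (.var 4) (.var 3)) (.mul (.get 5 (.lit 0) (.var 4)) (.get 5 (.lit 0) (.var 3))))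
    7 (.succ (.succ (.var 5))))

/-- Binary increment of the vector `u` in row `0` of array `5`; the carry is in array `10`. -/
def Prog.increment : Prog :=
  .seq (.setF 10 (.lit 0) (.lit 0) .one) (.forTo 3 (.get 0 (.lit 1))
    (.seq (.setF 12 (.lit 0) (.lit 0)
        (.mul (.get 5 (.lit 0) (.var 3)) (.get 10 (.lit 0) (.lit 0))))
      (.seq (.setF 5 (.lit 0) (.var 3)
          (.add (.get 5 (.lit 0) (.var 3)) (.get 10 (.lit 0) (.lit 0))))
        (.setF 10 (.lit 0) (.lit 0) (.get 12 (.lit 0) (.lit 0))))))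

/-! ### Correctness of the building blocks -/

section Blocks

variable {F : Type*}

/-- The integers on which the loops depend. -/
structure Params (s : Store F) (n t p k W d : ℕ) : Prop where
  hn : s.int 0 0 = n
  ht : s.int 0 1 = t
  hp : s.int 0 2 = p
  hk : s.int 0 3 = k
  hW : s.int 1 0 = W
  hd : s.int 2 0 = d

theorem Params.congr {s s' : Store F} {n t p k W d : ℕ} (h : Params s n t p k W d)
    (h0 : s'.int 0 = s.int 0) (h1 : s'.int 1 = s.int 1) (h2 : s'.int 2 = s.int 2) :
    Params s' n t p k W d := by
  cases h
  constructor <;> simp [*]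

/-- Row `l` of array `7` stores the coefficients below `W` of the polynomial `g l`. -/
def StoresPoly [Field F] (W : ℕ) (s : Store F) (g : ℕ → Polynomial F) : Prop :=
  ∀ l, ∀ x < W, s.fld 7 l x = (g l).coeff x

variable [Field F] {o : (ℕ → F) → F} {n t p k W d : ℕ}

/-- The reads in column `x - off` are not affected by the earlier writes since the rows differ. -/
theorem addRow_spec {s : Store F} {d : ℕ} {i off : IExp} {c : FExp} {b : ℕ} {l : IExp}
    {i₀ off₀ l₀ : ℕ} {c₀ : F} (hW : s.int 1 0 = W)
    (hi : ∀ s' : Store F, (∀ a, a ≠ 7 → a ≠ 8 → s'.int a = s.int a) → i.eval s' = i₀)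
    (hoff : off.eval s = off₀)
    (hl : ∀ s' : Store F, (∀ a, a ≠ 7 → a ≠ 8 → s'.int a = s.int a) → l.eval s' = l₀)
    (hc : ∀ s' : Store F, (∀ a, a ≠ 7 → a ≠ 8 → s'.int a = s.int a) →
      (∀ a, a ≠ d → s'.fld a = s.fld a) → c.eval s' = c₀)
    (hne : d ≠ b ∨ i₀ ≠ l₀) :
    HaltsWithin o (.addRow d i off c b l) s (4 * W + 3) (fun s' =>
      s'.fld d = Function.update (s.fld d) i₀ (fun x => s.fld d i₀ x +
        if off₀ ≤ x ∧ x < off₀ + W then c₀ * s.fld b l₀ (x - off₀) else 0)) := by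
  have h1 : HaltsWithin o (.setI 8 (.lit 0) off) s 1 (fun s' => s' = s.setI 8 0 off₀) :=
    HaltsWithin.setI (by simp [IExp.eval, hoff])
  refine (h1.seq (N₂ := W * (2 + 2) + 2) ?_).mono (by omega) (fun _ h => h)
  rintro s' - rfl
  have key := HaltsWithin.forTo (o := o) (v := 7) (b := .var 1)
    (p := .seq (.setF d i (.var 8) (.add (.get d i (.var 8)) (.mul c (.get b l (.var 7)))))
      (.setI 8 (.lit 0) (.succ (.var 8)))) (s := s.setI 8 0 off₀) (M := W) (K := 2)
    (fun w s' => s'.int 8 0 = off₀ + w ∧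
      s'.fld d = Function.update (s.fld d) i₀ (fun x => s.fld d i₀ x +
        if off₀ ≤ x ∧ x < off₀ + w then c₀ * s.fld b l₀ (x - off₀) else 0))
    (by simp [Prog.intWrites]) ?_ ?_ ?_
  · exact key.mono le_rfl (fun _ h => h.2)
  · intro s' hu
    rw [IExp.eval, hu.int 1 (by simp [Prog.forTo, Prog.intWrites])]
    simp [IExp.eval, Store.setI_int_ne, hW]
  · refine ⟨by simp [Store.setI_int_ne], ?_⟩
    simp only [Store.setI_fld]
    rw [show (fun x => s.fld d i₀ x + if off₀ ≤ x ∧ x < off₀ + 0 then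
      c₀ * s.fld b l₀ (x - off₀) else 0) = s.fld d i₀ from ?_, Function.update_eq_self]
    funext x
    rw [if_neg (by omega), add_zero]
  · rintro w hw s' hu h7 ⟨h8, hd⟩
    have hint : ∀ a, a ≠ 7 → a ≠ 8 → s'.int a = s.int a := by
      intro a ha ha'
      rw [hu.int a (by simp [Prog.forTo, Prog.intWrites, ha, ha']), Store.setI_int_ne _ ha']
    have hfld : ∀ a, a ≠ d → s'.fld a = s.fld a := by
      intro a ha
      rw [hu.fld a (by simp [Prog.forTo, Prog.fldWrites, ha]), Store.setI_fld]
    have hb : s'.fld b l₀ = s.fld b l₀ := by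
      by_cases hbd : b = d
      · subst hbd
        have : l₀ ≠ i₀ := by rcases hne with h | h <;> [exact absurd rfl h; exact h.symm]
        rw [hd, Function.update_of_ne this]
      · rw [hfld b hbd]
    refine HaltsWithin.seq (N₁ := 1) (N₂ := 1) (HaltsWithin.setF (R := fun s'' =>
      s'' = s'.setF d i₀ (off₀ + w) (s'.fld d i₀ (off₀ + w) + c₀ * s.fld b l₀ w)) ?_) ?_
    · simp only [FExp.eval, hi s' hint, hl s' hint, hc s' hint hfld, IExp.eval, h8, h7, hb]
    · rintro s'' - rfl
      refine HaltsWithin.setI ?_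
      refine ⟨by simp [IExp.eval, h8, Store.setI_int_ne, add_assoc], ?_⟩
      simp only [Store.setI_fld, Store.setF_fld_self, hd, Function.update_self,
        Function.update_idem]
      congr 1
      funext x
      by_cases hx : x = off₀ + w
      · subst hx
        rw [Function.update_self, if_neg (by omega), if_pos (by omega)]
        simp
      · rw [Function.update_of_ne hx]
        congr 1
        by_cases h : off₀ ≤ x ∧ x < off₀ + w
        · rw [if_pos h, if_pos (by omega)]
        · rw [if_neg h, if_neg (by omega)]

theorem addRow_rep {s : Store F} {i off : IExp} {c : FExp} {l : IExp} {i₀ off₀ l₀ : ℕ} {c₀ : F}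
    {g : ℕ → Polynomial F} (hg : StoresPoly W s g) (hW : s.int 1 0 = W)
    (hi : ∀ s' : Store F, (∀ a, a ≠ 7 → a ≠ 8 → s'.int a = s.int a) → i.eval s' = i₀)
    (hoff : off.eval s = off₀)
    (hl : ∀ s' : Store F, (∀ a, a ≠ 7 → a ≠ 8 → s'.int a = s.int a) → l.eval s' = l₀)
    (hc : ∀ s' : Store F, (∀ a, a ≠ 7 → a ≠ 8 → s'.int a = s.int a) →
      (∀ a, a ≠ 7 → s'.fld a = s.fld a) → c.eval s' = c₀)
    (hne : i₀ ≠ l₀) :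
    HaltsWithin o (.addRow 7 i off c 7 l) s (4 * W + 3) (fun s' =>
      StoresPoly W s' (Function.update g i₀ (g i₀ + Polynomial.C c₀ * Polynomial.X ^ off₀ * g l₀))) := by
  refine (addRow_spec hW hi hoff hl hc (Or.inr hne)).mono le_rfl ?_
  intro s' hs' r x hx
  rw [hs']
  by_cases hr : r = i₀
  · subst hr
    simp only [Function.update_self, hg r x hx, Polynomial.coeff_add, mul_assoc,
      Polynomial.coeff_C_mul, Polynomial.coeff_X_pow_mul']
    congr 1
    by_cases h : off₀ ≤ x
    · rw [if_pos ⟨h, by omega⟩, if_pos h, hg _ _ (by omega)]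
    · rw [if_neg (fun h' => h h'.1), if_neg h, mul_zero]
  · simp only [Function.update_of_ne hr, hg r x hx]

theorem StoresPoly.congr {s s' : Store F} {g : ℕ → Polynomial F} (h : StoresPoly W s g)
    (h7 : s'.fld 7 = s.fld 7) : StoresPoly W s' g := by
  intro l x hx; rw [h7, h l x hx]

theorem point_spec {s : Store F} (hP : Params s n t p k W d) :
    HaltsWithin o .point s (n * ((1 + (t * 3 + 2)) + 2) + 2) (fun s' =>
      ∀ i < n, s'.fld 6 0 i =
        ∑ j ∈ Finset.range t, s.fld 2 j i * s.fld 5 0 j * s.fld 3 0 i) := by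
  refine HaltsWithin.forTo (fun m s' => ∀ i < m, s'.fld 6 0 i =
        ∑ j ∈ Finset.range t, s.fld 2 j i * s.fld 5 0 j * s.fld 3 0 i)
    (by simp [Prog.forTo, Prog.intWrites]) ?_ (by simp) ?_
  · intro s' hu
    simp [IExp.eval, hu.int 0 (by simp [Prog.forTo, Prog.intWrites]), hP.hn]
  · intro i hi s' hu h3 hI
    refine (HaltsWithin.setF (R := fun s'' => s'' = s'.setF 6 0 i 0)
      (by simp [IExp.eval, FExp.eval, h3])).seq ?_
    rintro s₁ - rfl
    refine (HaltsWithin.forTo (K := 1) (M := t) (fun m s'' => (∀ i' < i, s''.fld 6 0 i' =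
        ∑ j ∈ Finset.range t, s.fld 2 j i' * s.fld 5 0 j * s.fld 3 0 i') ∧
        s''.fld 6 0 i = ∑ j ∈ Finset.range m, s.fld 2 j i * s.fld 5 0 j * s.fld 3 0 i)
      (by simp [Prog.intWrites]) ?_ ?_ ?_).mono le_rfl ?_
    · intro s'' hu'
      simp [IExp.eval, hu'.int 0 (by simp [Prog.forTo, Prog.intWrites]),
        hu.int 0 (by simp [Prog.forTo, Prog.intWrites]), hP.ht]
    · refine ⟨fun i' hi' => ?_, by simp [Store.setF]⟩
      simp only [Store.setI_fld, Store.setF_fld_self, Function.update_self,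
        Function.update_of_ne hi'.ne, hI i' hi']
    · rintro j hj s'' hu' h4 ⟨h1, h2⟩
      have e3 : s''.int 3 0 = i := by
        rw [hu'.int 3 (by simp [Prog.forTo, Prog.intWrites])]; simpa using h3
      have hf : ∀ a, a ≠ 6 → s''.fld a = s.fld a := by
        intro a ha
        rw [hu'.fld a (by simp [Prog.forTo, Prog.fldWrites, ha]), Store.setF_fld_ne _ ha,
          hu.fld a (by simp [Prog.forTo, Prog.fldWrites, ha])]
      refine HaltsWithin.setF ⟨fun i' hi' => ?_, ?_⟩
      · simp only [IExp.eval, e3, Store.setI_fld, Store.setF_fld_self, Function.update_self,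
          Function.update_of_ne hi'.ne, h1 i' hi']
      · simp only [IExp.eval, FExp.eval, e3, h4, Store.setI_fld, Store.setF_fld_self,
          Function.update_self, h2, Finset.sum_range_succ, hf 2 (by decide), hf 3 (by decide),
          hf 5 (by decide)]
    · rintro s'' ⟨h1, h2⟩ i' hi'
      rcases Nat.lt_succ_iff_lt_or_eq.mp hi' with h | rfl
      · exact h1 i' h
      · exact h2

theorem clear_spec {s : Store F} (hP : Params s n t p k W d)
    (h0 : ∀ l, t < l → ∀ x < W, s.fld 7 l x = 0) :
    HaltsWithin o .clear s (((t + 1) * ((W * 3 + 2) + 2) + 2) + 1) (fun s' =>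
      StoresPoly W s' (Pi.single t 1)) := by
  refine HaltsWithin.seq (R₁ := fun s' => ∀ l, ∀ x < W, s'.fld 7 l x = 0) ?_ ?_
  · refine (HaltsWithin.forTo (K := W * 3 + 2) (M := t + 1)
      (fun m s' => ∀ l, (l < m ∨ t < l) → ∀ x < W, s'.fld 7 l x = 0)
      (by simp [Prog.forTo, Prog.intWrites]) ?_ ?_ ?_).mono le_rfl ?_
    · intro s' hu
      simp [IExp.eval, hu.int 0 (by simp [Prog.forTo, Prog.intWrites]), hP.ht]
    · simpa using h0
    · intro l hl s' hu h5 hI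
      refine (HaltsWithin.forTo (K := 1) (M := W)
        (fun m s'' => (∀ l', (l' < l ∨ t < l') → ∀ x < W, s''.fld 7 l' x = 0) ∧
          ∀ x < m, s''.fld 7 l x = 0)
        (by simp [Prog.intWrites]) ?_ ?_ ?_).mono le_rfl ?_
      · intro s'' hu'
        simp [IExp.eval, hu'.int 1 (by simp [Prog.forTo, Prog.intWrites]),
          hu.int 1 (by simp [Prog.forTo, Prog.intWrites]), hP.hW]
      · exact ⟨by simpa using hI, by simp⟩
      · rintro x hx s'' hu' h7 ⟨h1, h2⟩
        have e5 : s''.int 5 0 = l := by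
          rw [hu'.int 5 (by simp [Prog.forTo, Prog.intWrites])]; exact h5
        refine HaltsWithin.setF ⟨fun l' hl' y hy => ?_, fun y hy => ?_⟩
        · simp only [IExp.eval, FExp.eval, e5, h7, Store.setI_fld, Store.setF_fld_self]
          rw [Function.update_of_ne (by omega), h1 l' hl' y hy]
        · simp only [IExp.eval, FExp.eval, e5, h7, Store.setI_fld, Store.setF_fld_self,
            Function.update_self]
          by_cases hxy : y = x
          · subst hxy; simp
          · rw [Function.update_of_ne hxy, h2 y (by omega)]
      · rintro s'' ⟨h1, h2⟩ l' hl' x hx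
        by_cases h : l' = l
        · subst h; exact h2 x hx
        · exact h1 l' (by omega) x hx
    · intro s' h l x hx
      exact h l (by omega) x hx
  · intro s' hu h
    refine HaltsWithin.setF ?_
    intro l x hx
    have et : s'.int 0 1 = t := by
      rw [hu.int 0 (by simp [Prog.forTo, Prog.intWrites]), hP.ht]
    simp only [IExp.eval, FExp.eval, et, Store.setF_fld_self]
    by_cases hl : l = t
    · subst hl
      simp only [Function.update_self, Pi.single_eq_same, Polynomial.coeff_one]
      by_cases hx0 : x = 0
      · subst hx0; simp
      · rw [Function.update_of_ne hx0, h _ _ hx, if_neg hx0]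
    · rw [Function.update_of_ne hl, h _ _ hx, Pi.single_eq_of_ne hl, Polynomial.coeff_zero]

theorem linearFactor_spec {s : Store F} (hP : Params s n t p k W d) {g : ℕ → Polynomial F}
    (hg : StoresPoly W s g) (hgt : ∀ l, t < l → g l = 0) {j : ℕ} (hj : s.int 4 0 = j) :
    HaltsWithin o .linearFactor s
      (1 + ((t * 3 + 2) + (t * (d * ((4 * W + 3) + 2) + 2 + 2) + 2))) (fun s' =>
      StoresPoly W s' (fun l => g l +
        Polynomial.C (∑ a ∈ Finset.range t, s.fld 1 a j * s.fld 5 0 a) *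
          (∑ v ∈ Finset.range d, Polynomial.C (s.fld 4 j v) * Polynomial.X ^ v) * g (l + 1))) := by
  set lam : F := ∑ a ∈ Finset.range t, s.fld 1 a j * s.fld 5 0 a with hlam
  refine (HaltsWithin.setF (R := fun s'' => s'' = s.setF 11 0 0 0)
      (by simp [IExp.eval, FExp.eval])).seq ?_
  rintro s₁ - rfl
  refine HaltsWithin.seq (R₁ := fun s' => s'.fld 11 0 0 = lam)
    (HaltsWithin.forTo (M := t) (K := 1) (fun m s' => s'.fld 11 0 0 =
      ∑ a ∈ Finset.range m, s.fld 1 a j * s.fld 5 0 a)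
      (by simp [Prog.intWrites]) ?_ (by simp [Store.setF]) ?_) ?_
  · intro s' hu
    simp [IExp.eval, hu.int 0 (by simp [Prog.forTo, Prog.intWrites]), hP.ht]
  · intro a ha s' hu h3 hI
    have e4 : s'.int 4 0 = j := by
      rw [hu.int 4 (by simp [Prog.forTo, Prog.intWrites])]; exact hj
    have hf : ∀ a, a ≠ 11 → s'.fld a = s.fld a := by
      intro a ha
      rw [hu.fld a (by simp [Prog.forTo, Prog.fldWrites, ha]), Store.setF_fld_ne _ ha]
    refine HaltsWithin.setF ?_
    simp only [IExp.eval, FExp.eval, e4, h3, Store.setI_fld, Store.setF_fld_self,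
          Function.update_self, hI, Finset.sum_range_succ, hf 1 (by decide), hf 5 (by decide)]
  · intro s₁ hu₁ h11
    have hf1 : ∀ a, a ≠ 11 → s₁.fld a = s.fld a := by
      intro a ha
      rw [hu₁.fld a (by simp [Prog.forTo, Prog.fldWrites, ha]), Store.setF_fld_ne _ ha]
    have hi1 : ∀ a, a ≠ 3 → s₁.int a = s.int a := by
      intro a ha
      rw [hu₁.int a (by simp [Prog.forTo, Prog.intWrites, ha])]; rfl
    set G : ℕ → Polynomial F := fun l => g l + Polynomial.C lam *
          (∑ v ∈ Finset.range d, Polynomial.C (s.fld 4 j v) * Polynomial.X ^ v) * g (l + 1) with hG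
    refine (HaltsWithin.forTo (M := t) (K := d * ((4 * W + 3) + 2) + 2)
      (fun m s' => StoresPoly W s' (fun l => if l < m then G l else g l))
      (by simp [Prog.forTo, Prog.addRow, Prog.intWrites]) ?_ ?_ ?_).mono le_rfl ?_
    · intro s' hu
      simp [IExp.eval, hu.int 0 (by simp [Prog.forTo, Prog.addRow, Prog.intWrites]), hi1, hP.ht]
    · simpa using hg.congr (s' := s₁.setI 5 0 0) (hf1 7 (by decide))
    · intro l hl s' hu h5 hI
      set h : ℕ → Polynomial F := fun l' => if l' < l then G l' else g l' with hh
      have hi2 : ∀ a, a ≠ 3 → a ≠ 5 → a ≠ 6 → a ≠ 7 → a ≠ 8 → s'.int a = s.int a := by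
        intro a h3 h5 h6 h7 h8
        rw [hu.int a (by simp [Prog.forTo, Prog.addRow, Prog.intWrites, *]), hi1 a h3]
      have hf2 : ∀ a, a ≠ 7 → s'.fld a = s₁.fld a := by
        intro a ha
        rw [hu.fld a (by simp [Prog.forTo, Prog.addRow, Prog.fldWrites, ha])]
      refine (HaltsWithin.forTo (M := d) (K := 4 * W + 3)
        (fun m s' => StoresPoly W s' (Function.update h l (g l + Polynomial.C lam *
          (∑ v ∈ Finset.range m, Polynomial.C (s.fld 4 j v) * Polynomial.X ^ v) * g (l + 1))))
        (by simp [Prog.forTo, Prog.addRow, Prog.intWrites]) ?_ ?_ ?_).mono le_rfl ?_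
      · intro s'' hu'
        simp [IExp.eval, hu'.int 2 (by simp [Prog.forTo, Prog.addRow, Prog.intWrites]), hi2, hP.hd]
      · have : Function.update h l (g l + Polynomial.C lam * (∑ v ∈ Finset.range 0,
            Polynomial.C (s.fld 4 j v) * Polynomial.X ^ v) * g (l + 1)) = h := by
          simp only [Finset.range_zero, Finset.sum_empty, mul_zero, zero_mul, add_zero]
          rw [show g l = h l by simp [hh], Function.update_eq_self]
        rw [this]
        exact hI.congr (by simp)
      · intro v hv s'' hu' h6 hI'
        have hi3 : ∀ a, a ≠ 6 → a ≠ 7 → a ≠ 8 → s''.int a = s'.int a := by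
          intro a h6 h7 h8
          rw [hu'.int a (by simp [Prog.forTo, Prog.addRow, Prog.intWrites, *])]
        have hf3 : ∀ a, a ≠ 7 → s''.fld a = s₁.fld a := by
          intro a ha
          rw [hu'.fld a (by simp [Prog.forTo, Prog.addRow, Prog.fldWrites, ha]), hf2 a ha]
        have e5 : s''.int 5 0 = l := by
          rw [hi3 5 (by decide) (by decide) (by decide)]; exact h5
        refine (addRow_rep (i₀ := l) (off₀ := v) (l₀ := l + 1) (c₀ := lam * s.fld 4 j v)
          hI' ?_ ?_ ?_ ?_ ?_ (by omega)).mono le_rfl ?_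
        · rw [hi3 1 (by decide) (by decide) (by decide), hi2 1 (by decide) (by decide) (by decide)
            (by decide) (by decide), hP.hW]
        · intro r hr
          simp [IExp.eval, hr, e5]
        · simp [IExp.eval, h6]
        · intro r hr
          simp [IExp.eval, hr, e5]
        · intro r hr hr'
          simp [FExp.eval, IExp.eval, hr, hr', hf3, h11, hf1, h6, hi3, hi2, hj]
        · intro r hr
          refine StoresPoly.congr (s := r) ?_ rfl
          convert hr using 1
          rw [Function.update_idem]
          congr 1
          rw [Function.update_self, Function.update_of_ne (by omega), Finset.sum_range_succ]
          simp only [hh, if_neg (show ¬ l + 1 < l by omega), Polynomial.C_mul]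
          ring
      · intro r hr
        refine StoresPoly.congr (s := r) ?_ rfl
        convert hr using 1
        funext l'
        by_cases h' : l' = l
        · subst h'
          simp [hG]
        · simp only [Function.update_of_ne h', hh]
          simp only [show (l' < l + 1) = (l' < l) from propext ⟨fun _ => by omega, fun _ => by omega⟩]
    · intro r hr
      convert hr using 1
      funext l
      split_ifs with h
      · rfl
      · simp only [hG]
        rw [hgt (l + 1) (by omega), mul_zero, add_zero]

theorem quadraticFactor_spec {s : Store F} (hP : Params s n t p k W d) {g : ℕ → Polynomial F}
    (hg : StoresPoly W s g) (hgt : ∀ l, t < l → g l = 0) {i j : ℕ} (hi : s.int 3 0 = i)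
    (hj : s.int 4 0 = j) :
    HaltsWithin o .quadraticFactor s (t * ((4 * W + 3) + 2) + 2) (fun s' =>
      StoresPoly W s' (fun l => g l +
        Polynomial.C (s.fld 0 j i * (s.fld 5 0 j * s.fld 5 0 i)) * g (l + 2))) := by
  set G : ℕ → Polynomial F := fun l => g l +
        Polynomial.C (s.fld 0 j i * (s.fld 5 0 j * s.fld 5 0 i)) * g (l + 2) with hG
  refine (HaltsWithin.forTo (M := t) (K := 4 * W + 3)
      (fun m s' => StoresPoly W s' (fun l => if l < m then G l else g l))
      (by simp [Prog.forTo, Prog.addRow, Prog.intWrites]) ?_ ?_ ?_).mono le_rfl ?_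
  · intro s' hu
    simp [IExp.eval, hu.int 0 (by simp [Prog.forTo, Prog.addRow, Prog.intWrites]), hP.ht]
  · simpa using hg.congr (s' := s.setI 5 0 0) rfl
  · intro l hl s' hu h5 hI
    have hi2 : ∀ a, a ≠ 5 → a ≠ 7 → a ≠ 8 → s'.int a = s.int a := by
      intro a h5 h7 h8
      rw [hu.int a (by simp [Prog.forTo, Prog.addRow, Prog.intWrites, *])]
    have hf2 : ∀ a, a ≠ 7 → s'.fld a = s.fld a := by
      intro a ha
      rw [hu.fld a (by simp [Prog.forTo, Prog.addRow, Prog.fldWrites, ha])]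
    refine (addRow_rep (i₀ := l) (off₀ := 0) (l₀ := l + 2)
      (c₀ := s.fld 0 j i * (s.fld 5 0 j * s.fld 5 0 i)) hI ?_ ?_ ?_ ?_ ?_ (by omega)).mono le_rfl ?_
    · rw [hi2 1 (by decide) (by decide) (by decide), hP.hW]
    · intro r hr
      simp [IExp.eval, hr, h5]
    · simp [IExp.eval]
    · intro r hr
      simp [IExp.eval, hr, h5]
    · intro r hr hr'
      simp [FExp.eval, IExp.eval, hr, hr', hf2, hi2, hi, hj]
    · intro r hr
      refine StoresPoly.congr (s := r) ?_ rfl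
      convert hr using 1
      funext l'
      by_cases h' : l' = l
      · subst h'
        simp [hG]
      · simp only [Function.update_of_ne h']
        simp only [show (l' < l + 1) = (l' < l) from propext ⟨fun _ => by omega, fun _ => by omega⟩]
  · intro r hr
    convert hr using 1
    funext l
    split_ifs with h
    · rfl
    · simp only [hG]
      rw [hgt (l + 2) (by omega), mul_zero, add_zero]

theorem Nat.testBit_add_one_eq_xor (m a : ℕ) :
    (m + 1).testBit a = (m.testBit a ^^ decide (2 ^ a ∣ m + 1)) := by
  simp only [Nat.testBit_eq_decide_div_mod_eq, Nat.succ_div]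
  by_cases h : 2 ^ a ∣ m + 1
  · rcases Nat.mod_two_eq_zero_or_one (m / 2 ^ a) with h' | h' <;> simp [h, h', Nat.add_mod]
  · simp [h]

theorem Nat.two_pow_succ_dvd_add_one_iff (m a : ℕ) :
    2 ^ (a + 1) ∣ m + 1 ↔ 2 ^ a ∣ m + 1 ∧ m.testBit a = true := by
  constructor
  · intro h
    have h' : 2 ^ a ∣ m + 1 := (pow_dvd_pow 2 (Nat.le_succ a)).trans h
    refine ⟨h', ?_⟩
    have h2 : 2 ∣ (m + 1) / 2 ^ a := by
      rw [Nat.dvd_div_iff_mul_dvd h', ← pow_succ]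
      exact h
    rw [Nat.succ_div_of_dvd h'] at h2
    rw [Nat.testBit_eq_decide_div_mod_eq, decide_eq_true_eq]
    omega
  · rintro ⟨h', h⟩
    rw [Nat.testBit_eq_decide_div_mod_eq, decide_eq_true_eq] at h
    rw [pow_succ, ← Nat.dvd_div_iff_mul_dvd h', Nat.succ_div_of_dvd h']
    omega

/-- In characteristic `2` the binary increment is addition and multiplication of bits. -/
theorem increment_spec [CharP F 2] {s : Store F} (hP : Params s n t p k W d) {m : ℕ}
    (hu5 : ∀ a < t, s.fld 5 0 a = if m.testBit a then 1 else 0) :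
    HaltsWithin o .increment s (1 + (t * ((1 + (1 + 1)) + 2) + 2)) (fun s' =>
      (∀ a < t, s'.fld 5 0 a = if (m + 1).testBit a then 1 else 0) ∧
        s'.fld 10 0 0 = if 2 ^ t ∣ m + 1 then 1 else 0) := by
  refine (HaltsWithin.setF (R := fun s'' => s'' = s.setF 10 0 0 1)
      (by simp [IExp.eval, FExp.eval])).seq ?_
  rintro s₁ - rfl
  refine (HaltsWithin.forTo (M := t) (K := 1 + (1 + 1)) (fun i s' =>
    (∀ a < t, s'.fld 5 0 a = if (if a < i then m + 1 else m).testBit a then 1 else 0) ∧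
      s'.fld 10 0 0 = if 2 ^ i ∣ m + 1 then 1 else 0)
      (by simp [Prog.intWrites]) ?_ ?_ ?_).mono le_rfl ?_
  · intro s' hu
    simp [IExp.eval, hu.int 0 (by simp [Prog.forTo, Prog.intWrites]), hP.ht]
  · refine ⟨?_, by simp [Store.setF]⟩
    intro a ha
    simp [Store.setF_fld_ne, hu5 a ha]
  · rintro i hi s' hu h3 ⟨h5, h10⟩
    have h5i := h5 i hi
    simp only [lt_irrefl, if_false] at h5i
    refine (HaltsWithin.setF (R := fun s'' => s'' = s'.setF 12 0 0 (s'.fld 5 0 i * s'.fld 10 0 0))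
      (by simp [IExp.eval, FExp.eval, h3])).seq ?_
    rintro s₁ - rfl
    refine (HaltsWithin.setF (R := fun s'' => s'' = (s'.setF 12 0 0
      (s'.fld 5 0 i * s'.fld 10 0 0)).setF 5 0 i (s'.fld 5 0 i + s'.fld 10 0 0))
      (by simp [IExp.eval, FExp.eval, h3, Store.setF_fld_ne])).seq ?_
    rintro s₁ - rfl
    refine HaltsWithin.setF ⟨?_, ?_⟩
    · intro a ha
      simp only [Store.setI_fld, Store.setF_fld_ne _ (show 5 ≠ 10 by decide), Store.setF_fld_self,
        Function.update_self, Store.setF_fld_ne _ (show 5 ≠ 12 by decide)]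
      by_cases hai : a = i
      · subst hai
        rw [Function.update_self, h5i, h10, if_pos (Nat.lt_succ_self a), Nat.testBit_add_one_eq_xor]
        by_cases h1 : m.testBit a <;> by_cases h2 : 2 ^ a ∣ m + 1 <;>
          simp [h1, h2, CharTwo.add_self_eq_zero]
      · rw [Function.update_of_ne hai, h5 a ha]
        simp only [show (a < i + 1) = (a < i) from propext ⟨fun _ => by omega, fun _ => by omega⟩]
    · simp only [Store.setI_fld, Store.setF_fld_self, Function.update_self, IExp.eval, FExp.eval,
        Store.setF_fld_ne _ (show 12 ≠ 5 by decide), h5i, h10, Nat.two_pow_succ_dvd_add_one_iff]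
      by_cases h1 : m.testBit i <;> by_cases h2 : 2 ^ i ∣ m + 1 <;> simp [h1, h2]
  · rintro r ⟨h5, h10⟩
    refine ⟨fun a ha => ?_, h10⟩
    rw [h5 a ha, if_pos ha]

end Blocks

/-! ### The sum over all subsets of the contracted set -/

/-- Computes in array `7` the polynomial by which the answer of the black box is weighted. -/
def Prog.factors : Prog :=
  .seq .clear (.seq (.forTo 4 (.get 0 (.lit 2)) .linearFactor)
    (.forTo 3 (.get 0 (.lit 1)) (.forTo 4 (.var 3) .quadraticFactor)))

/-- Adds to array `8` the contributions of all `0`-`1` vectors `u`. -/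
def Prog.sumSubsets : Prog :=
  .loop (.isZero (.get 10 (.lit 0) (.lit 0)))
    (.seq .point (.seq (.query 9 (.lit 0) (.lit 0) 6 (.lit 0)) (.seq .factors
      (.seq (.addRow 8 (.lit 0) (.lit 0) (.get 9 (.lit 0) (.lit 0)) 7 (.get 0 (.lit 3)))
        .increment))))

/-- Sets the number of digits of a random polynomial, `p + 3`, and the number
`p * (p + 3) + 1` of coefficients that are kept of a polynomial. -/
def Prog.widths : Prog :=
  .seq (.setI 2 (.lit 0) (.succ (.succ (.succ (.get 0 (.lit 2))))))
    (.seq (.setI 1 (.lit 0) (.lit 1))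
      (.forTo 3 (.get 0 (.lit 2)) (.forTo 4 (.var 2) (.setI 1 (.lit 0) (.succ (.var 1))))))

section ReversedCoeff

variable {R : Type*} [CommRing R]

open Polynomial

/-- The coefficient of `X ^ (t - l)`, and `0` if `l > t`. -/
noncomputable def reversedCoeff (t : ℕ) (q : R[X]) (l : ℕ) : R :=
  if l ≤ t then q.coeff (t - l) else 0

theorem reversedCoeff_of_lt {t : ℕ} (q : R[X]) {l : ℕ} (h : t < l) : reversedCoeff t q l = 0 :=
  if_neg (by omega)

theorem reversedCoeff_one (t : ℕ) : reversedCoeff t (1 : R[X]) = Pi.single t 1 := by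
  funext l
  by_cases h : l = t
  · subst h; simp [reversedCoeff]
  · rw [Pi.single_eq_of_ne h, reversedCoeff, coeff_one]
    split_ifs <;> first | rfl | omega

theorem reversedCoeff_mul (t : ℕ) (q : R[X]) (a : R) (d l : ℕ) :
    reversedCoeff t (q * (1 + C a * X ^ d)) l =
      reversedCoeff t q l + a * reversedCoeff t q (l + d) := by
  unfold reversedCoeff
  have h : q * (1 + C a * X ^ d) = q + C a * (q * X ^ d) := by ring
  rw [h, coeff_add, coeff_C_mul, coeff_mul_X_pow']
  by_cases h1 : l ≤ t
  · rw [if_pos h1, if_pos h1]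
    by_cases h2 : l + d ≤ t
    · rw [if_pos h2, if_pos (by omega), Nat.sub_sub]
    · rw [if_neg h2, if_neg (by omega)]
  · rw [if_neg h1, if_neg h1, if_neg (by omega), mul_zero, add_zero]

end ReversedCoeff

section SumSubsets

variable {F : Type*} [Field F]

open Polynomial

/-- The polynomial `∏ j, (1 + ζ z j (∑ a, E a j * u a)) * ∏ (j < i), (1 + ζ ^ 2 B j i * u j * u i)`
in `ζ`; the polynomials `z j` in a second variable have the coefficients `Z j v`, `v < d`. -/
noncomputable def weightPoly (t p d : ℕ) (B E Z : ℕ → ℕ → F) (u : ℕ → F) : F[X][X] :=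
  (∏ j ∈ Finset.range p, (1 + C (C (∑ a ∈ Finset.range t, E a j * u a) *
    (∑ v ∈ Finset.range d, C (Z j v) * X ^ v)) * X ^ 1)) *
  ∏ i ∈ Finset.range t, ∏ j ∈ Finset.range i, (1 + C (C (B j i * (u j * u i))) * X ^ 2)

theorem weightPoly_congr {t p d : ℕ} {B E Z : ℕ → ℕ → F} {u u' : ℕ → F}
    (h : ∀ a < t, u a = u' a) : weightPoly t p d B E Z u = weightPoly t p d B E Z u' := by
  have h1 : ∀ j, ∑ a ∈ Finset.range t, E a j * u a = ∑ a ∈ Finset.range t, E a j * u' a :=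
    fun j => Finset.sum_congr rfl fun a ha => by rw [h a (Finset.mem_range.mp ha)]
  have h2 : ∏ i ∈ Finset.range t, ∏ j ∈ Finset.range i,
        ((1 : F[X][X]) + C (C (B j i * (u j * u i))) * X ^ 2) =
      ∏ i ∈ Finset.range t, ∏ j ∈ Finset.range i,
        (1 + C (C (B j i * (u' j * u' i))) * X ^ 2) := by
    refine Finset.prod_congr rfl fun i hi => Finset.prod_congr rfl fun j hj => ?_
    have hi := Finset.mem_range.mp hi
    have hj := Finset.mem_range.mp hj
    rw [h i hi, h j (by omega)]
  simp only [weightPoly, h1, h2]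

/-- The binary digits of `m` as field elements. -/
def bits (F : Type*) [Field F] (m a : ℕ) : F := if m.testBit a then 1 else 0

/-- The point at which the black box is queried. -/
def queryPoint (t : ℕ) (C' x : ℕ → ℕ → F) (u : ℕ → F) (i : ℕ) : F :=
  ∑ j ∈ Finset.range t, C' j i * u j * x 0 i

/-- The contribution of the first `M` of the `0`-`1` vectors, read off from the input arrays. -/
noncomputable def partialSum (o : (ℕ → F) → F) (t p k d : ℕ) (A : ℕ → ℕ → ℕ → F) (M : ℕ) : F[X] :=
  ∑ m ∈ Finset.range M, C (o (queryPoint t (A 2) (A 3) (bits F m))) *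
    reversedCoeff t (weightPoly t p d (A 0) (A 1) (A 4) (bits F m)) k

variable {o : (ℕ → F) → F} {n t p k W d : ℕ}

/-- An upper bound for the running time of `Prog.factors`. -/
def factorsTime (t p W d : ℕ) : ℕ :=
  ((t + 1) * ((W * 3 + 2) + 2) + 2) + 1 +
    ((p * ((1 + ((t * 3 + 2) + (t * (d * ((4 * W + 3) + 2) + 2 + 2) + 2))) + 2) + 2) +
    (t * ((t * ((t * ((4 * W + 3) + 2) + 2) + 2) + 2) + 2) + 2))

theorem factors_spec {s : Store F} (hP : Params s n t p k W d)
    (h0 : ∀ l, t < l → ∀ x < W, s.fld 7 l x = 0) :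
    HaltsWithin o .factors s (factorsTime t p W d) (fun s' =>
      StoresPoly W s' (reversedCoeff t
        (weightPoly t p d (s.fld 0) (s.fld 1) (s.fld 4) (s.fld 5 0)))) := by
  refine (clear_spec hP h0).seq ?_
  intro s₁ hu₁ h1
  have hi1 : ∀ a, a ∉ Prog.clear.intWrites → s₁.int a = s.int a := hu₁.int
  have hf1 : ∀ a, a ∉ Prog.clear.fldWrites → s₁.fld a = s.fld a := hu₁.fld
  have hP1 : Params s₁ n t p k W d :=
    hP.congr (hi1 _ (by decide)) (hi1 _ (by decide)) (hi1 _ (by decide))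
  set L : ℕ → F[X][X] := fun j => (1 + C (C (∑ a ∈ Finset.range t, s.fld 1 a j * s.fld 5 0 a) *
    (∑ v ∈ Finset.range d, C (s.fld 4 j v) * X ^ v)) * X ^ 1) with hL
  set Q : ℕ → ℕ → F[X][X] := fun i j =>
    (1 + C (C (s.fld 0 j i * (s.fld 5 0 j * s.fld 5 0 i))) * X ^ 2) with hQ
  refine (HaltsWithin.forTo (M := p)
    (fun m s' => StoresPoly W s' (reversedCoeff t (∏ j ∈ Finset.range m, L j)))
    (by decide) ?_ ?_ ?_).seq ?_
  · intro s' hu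
    rw [IExp.eval, hu.int 0 (by decide)]
    exact hP1.hp
  · rw [Finset.range_zero, Finset.prod_empty, reversedCoeff_one]
    exact h1.congr rfl
  · intro j hj s' hu h4 hI
    have hf : ∀ a ∈ [1, 4, 5], s'.fld a = s.fld a := by
      intro a ha
      rw [hu.fld a (by fin_cases ha <;> decide), hf1 a (by fin_cases ha <;> decide)]
    refine (linearFactor_spec (hP1.congr (hu.int 0 (by decide)) (hu.int 1 (by decide))
      (hu.int 2 (by decide))) hI (fun l hl => reversedCoeff_of_lt _ hl) h4).mono le_rfl ?_
    intro r hr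
    refine StoresPoly.congr (s := r) ?_ rfl
    convert hr using 1
    funext l
    rw [Finset.prod_range_succ, hL, reversedCoeff_mul, hf 1 (by simp), hf 4 (by simp),
      hf 5 (by simp)]
  · intro s₂ hu₂ h2
    have hi2 : ∀ a ∈ [0, 1, 2], s₂.int a = s₁.int a := by
      intro a ha
      rw [hu₂.int a (by fin_cases ha <;> decide)]
    have hP2 : Params s₂ n t p k W d := hP1.congr (hi2 _ (by simp)) (hi2 _ (by simp))
      (hi2 _ (by simp))
    have hf2 : ∀ a ∈ [0, 5], s₂.fld a = s.fld a := by
      intro a ha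
      rw [hu₂.fld a (by fin_cases ha <;> decide), hf1 a (by fin_cases ha <;> decide)]
    refine (HaltsWithin.forTo (M := t) (K := (t * ((t * ((4 * W + 3) + 2) + 2) + 2) + 2))
      (fun m s' => StoresPoly W s' (reversedCoeff t ((∏ j ∈ Finset.range p, L j) *
        ∏ i ∈ Finset.range m, ∏ j ∈ Finset.range i, Q i j)))
      (by decide) ?_ ?_ ?_).mono le_rfl ?_
    · intro s' hu
      rw [IExp.eval, hu.int 0 (by decide)]
      exact hP2.ht
    · rw [Finset.range_zero, Finset.prod_empty, mul_one]
      exact h2.congr rfl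
    · intro i hi s' hu h3 hI
      refine (HaltsWithin.forTo (M := i) (K := t * ((4 * W + 3) + 2) + 2)
        (fun m s' => StoresPoly W s' (reversedCoeff t ((∏ j ∈ Finset.range p, L j) *
          (∏ i ∈ Finset.range i, ∏ j ∈ Finset.range i, Q i j) *
            ∏ j ∈ Finset.range m, Q i j)))
        (by decide) ?_ ?_ ?_).mono ?_ ?_
      · intro s'' hu'
        rw [IExp.eval, hu'.int 3 (by decide)]
        exact h3
      · rw [Finset.range_zero, Finset.prod_empty, mul_one]
        exact hI.congr rfl
      · intro j hj s'' hu' h4 hI'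
        have hf : ∀ a ∈ [0, 5], s''.fld a = s.fld a := by
          intro a ha
          rw [hu'.fld a (by fin_cases ha <;> decide), hu.fld a (by fin_cases ha <;> decide),
            hf2 a ha]
        have hi : ∀ a ∈ [0, 1, 2], s''.int a = s₂.int a := by
          intro a ha
          rw [hu'.int a (by fin_cases ha <;> decide), hu.int a (by fin_cases ha <;> decide)]
        refine (quadraticFactor_spec (hP2.congr (hi 0 (by simp)) (hi 1 (by simp))
          (hi 2 (by simp))) hI' (fun l hl => reversedCoeff_of_lt _ hl)
          ((congrFun (hu'.int 3 (by decide)) 0).trans h3) h4).mono le_rfl ?_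
        intro r hr
        refine StoresPoly.congr (s := r) ?_ rfl
        convert hr using 1
        funext l
        rw [Finset.prod_range_succ, ← mul_assoc, hQ, reversedCoeff_mul, hf 0 (by simp),
          hf 5 (by simp)]
      · gcongr
      · intro r hr
        refine StoresPoly.congr (s := r) ?_ rfl
        rw [Finset.prod_range_succ, ← mul_assoc]
        exact hr
    · intro r hr
      exact hr

/-- An upper bound for the running time of a pass of `Prog.sumSubsets`. -/
def passTime (n t p W d : ℕ) : ℕ :=
  (n * ((1 + (t * 3 + 2)) + 2) + 2) + (1 + (factorsTime t p W d + ((4 * W + 3) +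
    (1 + (t * ((1 + (1 + 1)) + 2) + 2)))))

/-- After `m` passes, `u` holds the binary digits of `m`, and the carry is set after the last
pass, when `m = 2 ^ t`. -/
theorem sumSubsets_spec [CharP F 2] (ho : ∀ v v' : ℕ → F, (∀ i < n, v i = v' i) → o v = o v')
    {s : Store F} (hP : Params s n t p k W d)
    (h7 : ∀ l, t < l → ∀ x < W, s.fld 7 l x = 0) (h5 : ∀ a < t, s.fld 5 0 a = 0)
    (h8 : ∀ x < W, s.fld 8 0 x = 0) (h10 : s.fld 10 0 0 = 0) :
    HaltsWithin o .sumSubsets s (2 ^ t * (passTime n t p W d + 1) + 1) (fun s' =>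
      ∀ x < W, s'.fld 8 0 x = (partialSum o t p k d s.fld (2 ^ t)).coeff x) := by
  refine (HaltsWithin.loop (M := 2 ^ t) (K := passTime n t p W d) (Inv := fun m s' =>
    (∀ l, t < l → ∀ x < W, s'.fld 7 l x = 0) ∧ (∀ a < t, s'.fld 5 0 a = bits F m a) ∧
    (∀ x < W, s'.fld 8 0 x = (partialSum o t p k d s.fld m).coeff x) ∧
    s'.fld 10 0 0 = if m = 2 ^ t then 1 else 0) ?_ ?_ ?_).mono le_rfl (fun _ h => h.2.2.1)
  · refine ⟨h7, fun a ha => by simp [bits, h5 a ha], fun x hx => by simp [partialSum, h8 x hx], ?_⟩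
    rw [if_neg (by positivity), h10]
  · rintro m hm s₀ hu ⟨g7, g5, g8, g10⟩
    have hf : ∀ a ∈ [0, 1, 2, 3, 4], s₀.fld a = s.fld a := fun a ha =>
      hu.fld a (by fin_cases ha <;> decide)
    have hP0 : Params s₀ n t p k W d := hP.congr (hu.int 0 (by decide)) (hu.int 1 (by decide))
      (hu.int 2 (by decide))
    refine ⟨by simp [Test.Holds, FExp.eval, IExp.eval, g10, hm.ne], ?_⟩
    refine (point_spec hP0).seq ?_
    intro s₁ hu₁ k1
    refine (HaltsWithin.query (R := fun s' => s' = s₁.setF 9 0 0 (o (s₁.fld 6 0))) rfl).seq ?_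
    rintro s₂ hu₂ rfl
    have hP2 : Params (s₁.setF 9 0 0 (o (s₁.fld 6 0))) n t p k W d :=
      hP0.congr (hu₁.int 0 (by decide)) (hu₁.int 1 (by decide)) (hu₁.int 2 (by decide))
    have hf2 : ∀ a ∉ [6, 9], (s₁.setF 9 0 0 (o (s₁.fld 6 0))).fld a = s₀.fld a := by
      intro a ha
      simp only [List.mem_cons, List.not_mem_nil, or_false, not_or] at ha
      rw [Store.setF_fld_ne _ ha.2,
        hu₁.fld a (by simp [Prog.point, Prog.forTo, Prog.fldWrites, ha.1])]
    have hq : (s₁.setF 9 0 0 (o (s₁.fld 6 0))).fld 9 0 0 =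
        o (queryPoint t (s.fld 2) (s.fld 3) (bits F m)) := by
      simp only [Store.setF_fld_self, Function.update_self]
      refine ho _ _ fun i hi => ?_
      rw [k1 i hi, hf 2 (by simp), hf 3 (by simp)]
      exact Finset.sum_congr rfl fun j hj => by rw [g5 j (Finset.mem_range.mp hj)]
    generalize s₁.setF 9 0 0 (o (s₁.fld 6 0)) = s₂ at hP2 hf2 hq
    refine (factors_spec hP2 (by rw [hf2 7 (by decide)]; exact g7)).seq ?_
    intro s₃ hu₃ k3
    have hw : weightPoly t p d (s₂.fld 0) (s₂.fld 1) (s₂.fld 4) (s₂.fld 5 0) =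
        weightPoly t p d (s.fld 0) (s.fld 1) (s.fld 4) (bits F m) := by
      rw [hf2 0 (by decide), hf2 1 (by decide), hf2 4 (by decide), hf2 5 (by decide),
        hf 0 (by simp), hf 1 (by simp), hf 4 (by simp)]
      exact weightPoly_congr g5
    rw [hw] at k3
    have hP3 : Params s₃ n t p k W d :=
      hP2.congr (hu₃.int 0 (by decide)) (hu₃.int 1 (by decide)) (hu₃.int 2 (by decide))
    have h83 : s₃.fld 8 = s₀.fld 8 := by rw [hu₃.fld 8 (by decide), hf2 8 (by decide)]
    have h53 : s₃.fld 5 = s₀.fld 5 := by rw [hu₃.fld 5 (by decide), hf2 5 (by decide)]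
    have h93 : s₃.fld 9 0 0 = o (queryPoint t (s.fld 2) (s.fld 3) (bits F m)) := by
      rw [hu₃.fld 9 (by decide), hq]
    refine (addRow_spec (i₀ := 0) (off₀ := 0) (l₀ := k)
      (c₀ := o (queryPoint t (s.fld 2) (s.fld 3) (bits F m))) hP3.hW ?_ ?_ ?_ ?_
      (Or.inl (by decide))).seq ?_
    · intro r hr; rfl
    · rfl
    · intro r hr
      simp [IExp.eval, hr, hP3.hk]
    · intro r hr hr'
      simp [IExp.eval, FExp.eval, hr', h93]
    · intro s₄ hu₄ k4
      have hP4 : Params s₄ n t p k W d :=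
        hP3.congr (hu₄.int 0 (by decide)) (hu₄.int 1 (by decide)) (hu₄.int 2 (by decide))
      refine (increment_spec (m := m) hP4 ?_).mono' le_rfl ?_
      · intro a ha
        rw [hu₄.fld 5 (by decide), h53, g5 a ha]
        rfl
      · rintro r hur ⟨hr, hr'⟩
        refine ⟨?_, hr, ?_, ?_⟩
        · intro l hl x hx
          rw [hur.fld 7 (by decide), hu₄.fld 7 (by decide), k3 l x hx, reversedCoeff_of_lt _ hl,
            coeff_zero]
        · intro x hx
          rw [hur.fld 8 (by decide), k4, Function.update_self, h83, g8 x hx,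
            if_pos (by omega), Nat.sub_zero, k3 k x hx, partialSum, partialSum,
            Finset.sum_range_succ, coeff_add, coeff_C_mul]
        · rw [hr']
          have : 2 ^ t ∣ m + 1 ↔ m + 1 = 2 ^ t :=
            ⟨fun h => le_antisymm hm (Nat.le_of_dvd (Nat.succ_pos m) h), fun h => h ▸ dvd_rfl⟩
          simp only [this]
  · rintro s' - ⟨-, -, -, g⟩
    simp [Test.Holds, FExp.eval, IExp.eval, g]

theorem widths_spec {s : Store F} (hn : s.int 0 0 = n) (ht : s.int 0 1 = t) (hp : s.int 0 2 = p)
    (hk : s.int 0 3 = k) :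
    HaltsWithin o .widths s (1 + (1 + (p * (((p + 3) * (1 + 2) + 2) + 2) + 2))) (fun s' =>
      Params s' n t p k (p * (p + 3) + 1) (p + 3)) := by
  refine (HaltsWithin.setI (R := fun s' => s' = s.setI 2 0 (p + 3))
    (by simp [IExp.eval, hp])).seq ?_
  rintro s₁ - rfl
  refine (HaltsWithin.setI (R := fun s' => s' = (s.setI 2 0 (p + 3)).setI 1 0 1)
    (by simp [IExp.eval])).seq ?_
  rintro s₁ - rfl
  refine (HaltsWithin.forTo (M := p) (fun m s' => s'.int 1 0 = m * (p + 3) + 1)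
    (by decide) ?_ (by simp [Store.setI_int_ne]) ?_).mono' le_rfl ?_
  · intro s' hu
    rw [IExp.eval, hu.int 0 (by decide)]
    simp [Store.setI_int_ne, IExp.eval, hp]
  · intro i hi s' hu h3 hI
    refine (HaltsWithin.forTo (M := p + 3) (K := 1)
      (fun m s' => s'.int 1 0 = i * (p + 3) + 1 + m) (by decide) ?_ ?_ ?_).mono le_rfl ?_
    · intro s'' hu'
      rw [IExp.eval, hu'.int 2 (by decide), hu.int 2 (by decide)]
      simp [Store.setI_int_ne, IExp.eval]
    · simpa [Store.setI_int_ne] using hI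
    · intro j hj s'' hu' h4 hI'
      refine HaltsWithin.setI ?_
      rw [Store.setI_int_ne _ (by decide)]
      simp only [IExp.eval, Store.setI_int_self, hI']
      rfl
    · intro r hr
      rw [Store.setI_int_ne _ (by decide), hr]
      ring
  · intro r hu hr
    constructor
    · simp [hu.int 0 (by decide), Store.setI_int_ne, hn]
    · simp [hu.int 0 (by decide), Store.setI_int_ne, ht]
    · simp [hu.int 0 (by decide), Store.setI_int_ne, hp]
    · simp [hu.int 0 (by decide), Store.setI_int_ne, hk]
    · exact hr
    · simp [hu.int 2 (by decide), Store.setI_int_ne]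

end SumSubsets

/-! ### Pfaffians in characteristic two -/

section Pfaffian

variable {R : Type*} [CommRing R] [CharP R 2]

theorem neg_one_eq_one_of_charP_two : (-1 : R) = 1 := CharTwo.neg_eq 1

theorem pfaffian_eq_sum {ι : Type*} [Fintype ι] [LinearOrder ι] (A : Matrix ι ι R) :
    pfaffian A = ∑ σ : Equiv.Perm ι with ∀ i, σ (σ i) = i ∧ σ i ≠ i,
      ∏ i with i < σ i, A i (σ i) := by
  unfold pfaffian
  refine Finset.sum_congr rfl fun σ _ => ?_
  rw [neg_one_eq_one_of_charP_two, one_pow, one_mul]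

theorem det_eq_sum_of_charP_two {ι : Type*} [Fintype ι] [DecidableEq ι] (A : Matrix ι ι R) :
    A.det = ∑ σ : Equiv.Perm ι, ∏ i, A (σ i) i := by
  rw [Matrix.det_apply]
  refine Finset.sum_congr rfl fun σ _ => ?_
  rcases Int.units_eq_one_or (Equiv.Perm.sign σ) with h | h <;> rw [h]
  · rw [one_smul]
  · rw [Units.neg_smul, one_smul, CharTwo.neg_eq]

/-- The permutations that are not involutions cancel in pairs `σ`, `σ⁻¹`, those with a fixed point
contribute zero, and the others contribute the squares of the terms of the Pfaffian. -/
theorem pfaffian_sq {ι : Type*} [Fintype ι] [LinearOrder ι] {A : Matrix ι ι R} (hA : IsSkew A) :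
    pfaffian A ^ 2 = A.det := by
  have hsymm : ∀ i j, A i j = A j i := fun i j => by
    have h := congrFun (congrFun hA.1 j) i
    rw [Matrix.transpose_apply, Matrix.neg_apply, CharTwo.neg_eq] at h
    exact h
  have hinv : ∀ σ : Equiv.Perm ι, ∏ i, A (σ⁻¹ i) i = ∏ i, A (σ i) i := by
    intro σ
    rw [← Equiv.prod_comp σ (fun i => A (σ⁻¹ i) i)]
    refine Finset.prod_congr rfl fun i _ => ?_
    rw [show σ⁻¹ (σ i) = i from σ.symm_apply_apply i, hsymm]
  rw [det_eq_sum_of_charP_two, pfaffian_eq_sum, CharTwo.sum_sq,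
    ← Finset.sum_filter_add_sum_filter_not Finset.univ
      (fun σ : Equiv.Perm ι => ∀ i, σ (σ i) = i ∧ σ i ≠ i)]
  have hzero : ∑ σ : Equiv.Perm ι with ¬ ∀ i, σ (σ i) = i ∧ σ i ≠ i, ∏ i, A (σ i) i = 0 := by
    refine Finset.sum_involution (fun σ _ => σ⁻¹) ?_ ?_ ?_ ?_
    · intro σ _
      rw [hinv, CharTwo.add_self_eq_zero]
    · intro σ hσ hne heq
      rw [Finset.mem_filter] at hσ
      refine hσ.2 fun i => ⟨?_, fun hi => hne ?_⟩
      · have h : σ⁻¹ (σ i) = i := σ.symm_apply_apply i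
        rwa [heq] at h
      · exact Finset.prod_eq_zero (Finset.mem_univ i) (by rw [hi, hA.2])
    · intro σ hσ
      simp only [Finset.mem_filter, Finset.mem_univ, true_and] at hσ ⊢
      intro h
      refine hσ fun i => ?_
      have h1 : σ⁻¹ (σ⁻¹ i) = i := (h i).1
      have h2 : σ⁻¹ i ≠ i := (h i).2
      have h3 : σ (σ i) = i := by
        conv_lhs => rw [← h1]
        simp
      refine ⟨h3, fun h4 => h2 ?_⟩
      conv_lhs => rw [← h4]
      simp
    · intro σ _
      exact inv_inv σ
  rw [hzero, add_zero]
  refine Finset.sum_congr rfl fun σ hσ => ?_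
  have hσ := (Finset.mem_filter.mp hσ).2
  rw [sq, ← Finset.prod_filter_mul_prod_filter_not Finset.univ (fun i => i < σ i)]
  congr 1
  · exact Finset.prod_congr rfl fun i _ => hsymm _ _
  · refine Finset.prod_bij (fun i _ => σ i) ?_ (fun _ _ _ _ h => σ.injective h) ?_ ?_
    · intro i hi
      rw [Finset.mem_filter] at hi ⊢
      rw [(hσ i).1]
      exact ⟨Finset.mem_univ _, not_lt.mpr hi.2.le⟩
    · intro i hi
      rw [Finset.mem_filter] at hi
      refine ⟨σ i, ?_, (hσ i).1⟩
      rw [Finset.mem_filter, (hσ i).1]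
      exact ⟨Finset.mem_univ _, lt_of_le_of_ne (not_lt.mp hi.2) (hσ i).2⟩
    · intro i _
      rw [(hσ i).1]

end Pfaffian

section Cover

variable {T S : Type*} [Fintype T] [LinearOrder T] [Fintype S]

/-- A perfect matching of `T ⊕ S` without edges inside `S`: the map `c.1` gives the partners of the
elements of `S`, and `c.2` is the set of edges inside `T`, each with its smaller end first.  That
no element of `T` is covered twice is a consequence of the number of edges. -/
structure IsCover (c : (S → T) × Finset (T × T)) : Prop where
  lt : ∀ e ∈ c.2, e.1 < e.2
  card : Fintype.card S + 2 * c.2.card = Fintype.card T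
  cover : ∀ a, (∃ s, c.1 s = a) ∨ ∃ e ∈ c.2, e.1 = a ∨ e.2 = a

open Classical in
/-- The sum over the perfect matchings of `T ⊕ S` without edges inside `S` of the products of the
edge weights, given by `B` inside `T` and by `M` between `T` and `S`. -/
noncomputable def coverSum {R : Type*} [CommRing R] (B : Matrix T T R) (M : Matrix T S R) : R :=
  ∑ c : (S → T) × Finset (T × T) with IsCover c, (∏ s, M (c.1 s) s) * ∏ e ∈ c.2, B e.1 e.2

/-- The involution of a matching.  The elements of `T` are numbered by the ends of the edges. -/
theorem IsCover.exists_perm {c : (S → T) × Finset (T × T)} (hc : IsCover c) {ι : Type*} [Fintype ι]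
    [LinearOrder ι] (e : T ⊕ S ≃ ι)
    (hlt : ∀ a b, e (.inl a) < e (.inl b) ↔ a < b) (hlt' : ∀ a s, e (.inl a) < e (.inr s)) :
    ∃ σ : Equiv.Perm ι, (∀ i, σ (σ i) = i ∧ σ i ≠ i) ∧
      (∀ s, σ (e (.inr s)) = e (.inl (c.1 s))) ∧
      (∀ p ∈ c.2, σ (e (.inl p.1)) = e (.inl p.2)) ∧
      ∀ {R : Type _} [CommRing R] (A : Matrix ι ι R), ∏ i with i < σ i, A i (σ i) =
        (∏ s, A (e (.inl (c.1 s))) (e (.inr s))) *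
          ∏ p ∈ c.2, A (e (.inl p.1)) (e (.inl p.2)) := by
  classical
  let X := S ⊕ (c.2 × Bool)
  let ψ : X → T := Sum.elim c.1 (fun q => if q.2 then q.1.1.2 else q.1.1.1)
  have hψ : Function.Bijective ψ := by
    rw [Fintype.bijective_iff_surjective_and_card]
    constructor
    · intro a
      rcases hc.cover a with ⟨s, hs⟩ | ⟨p, hp, h | h⟩
      · exact ⟨.inl s, hs⟩
      · exact ⟨.inr (⟨p, hp⟩, false), h⟩
      · exact ⟨.inr (⟨p, hp⟩, true), h⟩
    · simp only [X, Fintype.card_sum, Fintype.card_prod, Fintype.card_coe, Fintype.card_bool]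
      rw [← hc.card, mul_comm]
  let f : X ⊕ S → X ⊕ S
    | .inl (.inl s) => .inr s
    | .inl (.inr (q, b)) => .inl (.inr (q, !b))
    | .inr s => .inl (.inl s)
  have hf : Function.Involutive f := by
    rintro ((s | ⟨q, b⟩) | s) <;> simp [f]
  have hf' : ∀ x, f x ≠ x := by
    rintro ((s | ⟨q, b⟩) | s) h
    · exact Sum.inr_ne_inl h
    · have h' := congrArg Prod.snd (Sum.inr_injective (Sum.inl_injective h))
      exact Bool.not_ne_self b h'
    · exact Sum.inl_ne_inr h
  let Ψ : X ⊕ S ≃ ι := (Equiv.sumCongr (Equiv.ofBijective ψ hψ) (Equiv.refl S)).trans e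
  have hΨ1 : ∀ s, Ψ (.inl (.inl s)) = e (.inl (c.1 s)) := fun s => rfl
  have hΨ2 : ∀ q, Ψ (.inl (.inr (q, false))) = e (.inl q.1.1) := fun q => rfl
  have hΨ3 : ∀ q, Ψ (.inl (.inr (q, true))) = e (.inl q.1.2) := fun q => rfl
  have hΨ4 : ∀ s, Ψ (.inr s) = e (.inr s) := fun s => rfl
  let σ : Equiv.Perm ι := Ψ.symm.trans ((hf.toPerm f).trans Ψ)
  have hσ : ∀ x, σ (Ψ x) = Ψ (f x) := fun x => by simp [σ]
  refine ⟨σ, ?_, ?_, ?_, ?_⟩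
  · intro i
    obtain ⟨x, rfl⟩ := Ψ.surjective i
    rw [hσ, hσ, hf]
    exact ⟨rfl, fun h => hf' x (Ψ.injective h)⟩
  · intro s
    rw [← hΨ4, hσ, ← hΨ1]
  · intro p hp
    rw [← hΨ2 ⟨p, hp⟩, hσ]
    exact hΨ3 ⟨p, hp⟩
  · intro R _ A
    rw [Finset.prod_filter, ← Equiv.prod_comp Ψ]
    simp only [hσ]
    rw [Fintype.prod_sum_type, Fintype.prod_sum_type, Fintype.prod_prod_type]
    simp only [Fintype.prod_bool, f, hΨ1, hΨ2, hΨ3, hΨ4, Bool.not_true, Bool.not_false, hlt, hlt',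
      if_true, (hlt' _ _).not_gt, if_false, Finset.prod_const_one, mul_one]
    congr 1
    rw [← Finset.prod_coe_sort c.2]
    refine Finset.prod_congr rfl fun q _ => ?_
    rw [if_neg (hc.lt q.1 q.2).not_gt, if_pos (hc.lt q.1 q.2), one_mul]

/-- The Pfaffian of a matrix with a vanishing block: the involutions that contribute are those
without a pair inside `S`, and they correspond to the matchings counted by `coverSum`. -/
theorem pfaffian_eq_coverSum {R : Type*} [CommRing R] [CharP R 2] {ι : Type*} [Fintype ι]
    [LinearOrder ι] {A : Matrix ι ι R} {B : Matrix T T R} {M : Matrix T S R} (e : T ⊕ S ≃ ι)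
    (hlt : ∀ a b, e (.inl a) < e (.inl b) ↔ a < b) (hlt' : ∀ a s, e (.inl a) < e (.inr s))
    (hB : ∀ a b, A (e (.inl a)) (e (.inl b)) = B a b)
    (hM : ∀ a s, A (e (.inl a)) (e (.inr s)) = M a s)
    (h0 : ∀ s s', A (e (.inr s)) (e (.inr s')) = 0) :
    pfaffian A = coverSum B M := by
  classical
  rw [pfaffian_eq_sum, ← Finset.sum_filter_of_ne (p := fun σ : Equiv.Perm ι =>
    ∀ s, ∃ a, σ (e (.inr s)) = e (.inl a))]
  · symm
    refine Finset.sum_bij (fun c hc => ((Finset.mem_filter.mp hc).2.exists_perm e hlt hlt').choose)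
      ?_ ?_ ?_ ?_
    · intro c hc
      obtain ⟨h1, h2, -, -⟩ :=
        ((Finset.mem_filter.mp hc).2.exists_perm e hlt hlt').choose_spec
      rw [Finset.mem_filter, Finset.mem_filter]
      exact ⟨⟨Finset.mem_univ _, h1⟩, fun s => ⟨_, h2 s⟩⟩
    · -- the matching is determined by its involution
      intro c hc c' hc' heq
      obtain ⟨h1, h2, h3, -⟩ :=
        ((Finset.mem_filter.mp hc).2.exists_perm e hlt hlt').choose_spec
      obtain ⟨h1', h2', h3', -⟩ :=
        ((Finset.mem_filter.mp hc').2.exists_perm e hlt hlt').choose_spec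
      rw [← heq] at h2' h3'
      generalize ((Finset.mem_filter.mp hc).2.exists_perm e hlt hlt').choose = σ at h1 h2 h3 h2' h3'
      have aux : ∀ c c' : (S → T) × Finset (T × T), IsCover c → IsCover c' →
          (∀ s, σ (e (.inr s)) = e (.inl (c'.1 s))) →
          (∀ p ∈ c.2, σ (e (.inl p.1)) = e (.inl p.2)) →
          (∀ p ∈ c'.2, σ (e (.inl p.1)) = e (.inl p.2)) → c.2 ⊆ c'.2 := by
        rintro c c' hc hc' h2' h3 h3' ⟨a, b⟩ hp
        have hab := hc.lt _ hp
        have hs := h3 _ hp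
        rcases hc'.cover a with ⟨s, hs'⟩ | ⟨p', hp', h | h⟩
        · have := (h1 (e (.inr s))).1
          rw [h2' s, hs', hs] at this
          exact absurd (e.injective this) (by simp)
        · obtain ⟨a', b'⟩ := p'
          obtain rfl : a' = a := h
          have h4 := h3' _ hp'
          rw [hs] at h4
          have : b = b' := by simpa using e.injective h4
          subst this
          exact hp'
        · obtain ⟨a', b'⟩ := p'
          obtain rfl : b' = a := h
          have h4 := (h1 (e (.inl a'))).1
          rw [h3' _ hp', hs] at h4
          have : b = a' := by simpa using e.injective h4
          subst this
          exact absurd (hc'.lt _ hp') hab.not_gt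
      have hcc := (Finset.mem_filter.mp hc).2
      have hcc' := (Finset.mem_filter.mp hc').2
      refine Prod.ext (funext fun s => ?_) (Finset.Subset.antisymm (aux c c' hcc hcc' h2' h3 h3')
        (aux c' c hcc' hcc h2 h3' h3))
      have h4 := h2 s
      rw [h2' s] at h4
      simpa using (e.injective h4).symm
    · intro σ hσ
      rw [Finset.mem_filter, Finset.mem_filter] at hσ
      obtain ⟨⟨-, h1⟩, h2⟩ := hσ
      choose φ hφ using h2
      have hφ' : ∀ s, σ (e (.inl (φ s))) = e (.inr s) := fun s => by rw [← hφ, (h1 _).1]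
      let E : Finset (T × T) :=
        Finset.univ.filter fun p => p.1 < p.2 ∧ σ (e (.inl p.1)) = e (.inl p.2)
      have hcov : ∀ a, (∃ s, φ s = a) ∨ ∃ p ∈ E, p.1 = a ∨ p.2 = a := by
        intro a
        obtain ⟨x, hx⟩ := e.surjective (σ (e (.inl a)))
        rcases x with b | s
        · right
          rcases lt_trichotomy a b with h | h | h
          · exact ⟨(a, b), by simp [E, h, hx], Or.inl rfl⟩
          · subst h
            exact absurd hx.symm (h1 _).2
          · refine ⟨(b, a), ?_, Or.inr rfl⟩
            simp only [E, Finset.mem_filter, Finset.mem_univ, true_and]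
            exact ⟨h, by rw [hx, (h1 _).1]⟩
        · left
          refine ⟨s, ?_⟩
          have := hφ s
          rw [hx, (h1 _).1] at this
          simpa using (e.injective this).symm
      have hinj : ∀ p ∈ E, ∀ p' ∈ E, p.1 ≠ p'.2 := by
        rintro ⟨a, b⟩ hp ⟨a', b'⟩ hp' (rfl : a = b')
        simp only [E, Finset.mem_filter, Finset.mem_univ, true_and] at hp hp'
        have h := (h1 (e (.inl a'))).1
        rw [hp'.2, hp.2] at h
        obtain rfl : b = a' := by simpa using e.injective h
        exact hp.1.not_gt hp'.1
      have hcov' : IsCover (φ, E) := by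
        refine ⟨fun p hp => (Finset.mem_filter.mp hp).2.1, ?_, hcov⟩
        have hb : Function.Bijective (Sum.elim φ (fun q => if q.2 then q.1.1.2 else q.1.1.1) :
            S ⊕ (E × Bool) → T) := by
          have key : ∀ s, ∀ p ∈ E, φ s ≠ p.1 ∧ φ s ≠ p.2 := by
            intro s p hp
            have hp := (Finset.mem_filter.mp hp).2.2
            constructor
            · intro h
              rw [← h, hφ'] at hp
              exact absurd (e.injective hp) (by simp)
            · intro h
              rw [← h, ← hφ] at hp
              exact absurd (e.injective (σ.injective hp)) (by simp)
          constructor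
          · rintro (s | ⟨⟨p, hp⟩, b⟩) (s' | ⟨⟨p', hp'⟩, b'⟩) h
            · have h : φ s = φ s' := h
              have h' := hφ' s
              rw [h, hφ'] at h'
              exact congrArg _ (by simpa using (e.injective h').symm)
            · cases b'
              · exact absurd h (key s p' hp').1
              · exact absurd h (key s p' hp').2
            · cases b
              · exact absurd h.symm (key s' p hp).1
              · exact absurd h.symm (key s' p hp).2
            · have hσp := (Finset.mem_filter.mp hp).2.2
              have hσp' := (Finset.mem_filter.mp hp').2.2
              cases b <;> cases b'
              · have h : p.1 = p'.1 := h
                rw [h, hσp'] at hσp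
                have h' : p'.2 = p.2 := by simpa using e.injective hσp
                obtain rfl : p = p' := Prod.ext h h'.symm
                rfl
              · exact absurd h (hinj p hp p' hp')
              · exact absurd h.symm (hinj p' hp' p hp)
              · have h : p.2 = p'.2 := h
                rw [h, ← hσp'] at hσp
                have h' : p.1 = p'.1 := by simpa using e.injective (σ.injective hσp)
                obtain rfl : p = p' := Prod.ext h' h
                rfl
          · intro a
            rcases hcov a with ⟨s, hs⟩ | ⟨p, hp, h | h⟩
            · exact ⟨.inl s, hs⟩
            · exact ⟨.inr (⟨p, hp⟩, false), h⟩
            · exact ⟨.inr (⟨p, hp⟩, true), h⟩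
        rw [← Fintype.card_of_bijective hb, Fintype.card_sum, Fintype.card_prod,
          Fintype.card_coe, Fintype.card_bool, mul_comm]
      refine ⟨(φ, E), Finset.mem_filter.mpr ⟨Finset.mem_univ _, hcov'⟩, ?_⟩
      obtain ⟨h1', h2', h3', -⟩ := (hcov'.exists_perm e hlt hlt').choose_spec
      generalize (hcov'.exists_perm e hlt hlt').choose = σ' at h1' h2' h3'
      ext i
      obtain ⟨x, rfl⟩ := e.surjective i
      rcases x with a | s
      · rcases hcov a with ⟨s, rfl⟩ | ⟨p, hp, rfl | rfl⟩
        · rw [hφ', ← h2', (h1' _).1]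
        · rw [h3' p hp, (Finset.mem_filter.mp hp).2.2]
        · rw [← h3' p hp, (h1' _).1, h3' p hp, ← (Finset.mem_filter.mp hp).2.2, (h1 _).1]
      · rw [h2', hφ]
    · intro c hc
      obtain ⟨-, -, -, h4⟩ :=
        ((Finset.mem_filter.mp hc).2.exists_perm e hlt hlt').choose_spec
      rw [h4 A]
      simp only [hM, hB]
  · -- an edge inside `S` has weight zero
    intro σ hσ hne s
    by_contra hcon
    have hσ := (Finset.mem_filter.mp hσ).2
    have hx : ∃ s', σ (e (.inr s)) = e (.inr s') := by
      obtain ⟨x, hx⟩ := e.surjective (σ (e (.inr s)))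
      rcases x with a | s'
      · exact absurd ⟨a, hx.symm⟩ hcon
      · exact ⟨s', hx.symm⟩
    obtain ⟨s', hs'⟩ := hx
    refine hne ?_
    rcases lt_or_gt_of_ne (hσ (e (.inr s))).2 with h | h
    · refine Finset.prod_eq_zero (i := σ (e (.inr s))) ?_ ?_
      · rw [Finset.mem_filter, (hσ _).1]
        exact ⟨Finset.mem_univ _, h⟩
      · rw [(hσ _).1, hs', h0]
    · refine Finset.prod_eq_zero (i := e (.inr s)) ?_ ?_
      · rw [Finset.mem_filter]
        exact ⟨Finset.mem_univ _, h⟩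
      · rw [hs', h0]

end Cover

/-! ### Extracting multilinear terms by summing over subsets -/

section Polarization

variable {T : Type*} [DecidableEq T] {R : Type*} [CommRing R]

/-- The characteristic vector of a set. -/
def charVec (R : Type*) [CommRing R] (U : Finset T) (a : T) : R := if a ∈ U then 1 else 0

theorem charVec_mul_self (U : Finset T) (a : T) : charVec R U a * charVec R U a = charVec R U a := by
  unfold charVec; split_ifs <;> simp

variable (T R) in
/-- The functions on the subsets of `T` that are polynomials of degree at most `d` in the entries
of the characteristic vector. -/
def degreeLE (d : ℕ) : Submodule R (Finset T → R) :=
  Submodule.span R ((fun (V U : Finset T) => if V ⊆ U then (1 : R) else 0) '' {V | V.card ≤ d})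

theorem degreeLE_mono {d d' : ℕ} (h : d ≤ d') : degreeLE T R d ≤ degreeLE T R d' :=
  Submodule.span_mono (Set.image_mono fun _ hV => le_trans hV h)

theorem one_mem_degreeLE : (1 : Finset T → R) ∈ degreeLE T R 0 :=
  Submodule.subset_span ⟨∅, by simp, by funext U; simp⟩

theorem charVec_mem_degreeLE (a : T) : (fun U => charVec R U a) ∈ degreeLE T R 1 :=
  Submodule.subset_span ⟨{a}, by simp, by funext U; simp [charVec]⟩

theorem mul_mem_degreeLE {d d' : ℕ} {f g : Finset T → R} (hf : f ∈ degreeLE T R d)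
    (hg : g ∈ degreeLE T R d') : f * g ∈ degreeLE T R (d + d') := by
  have h := Submodule.mul_mem_mul hf hg
  rw [degreeLE, degreeLE, Submodule.span_mul_span] at h
  refine Submodule.span_le.mpr ?_ h
  rintro _ ⟨_, ⟨V, hV, rfl⟩, _, ⟨V', hV', rfl⟩, rfl⟩
  refine Submodule.subset_span ⟨V ∪ V', (Finset.card_union_le _ _).trans (add_le_add hV hV'), ?_⟩
  funext U
  simp [Finset.union_subset_iff, ← ite_and, and_comm]

theorem prod_mem_degreeLE {ι : Type*} (s : Finset ι) {d : ι → ℕ} {f : ι → Finset T → R}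
    (hf : ∀ i ∈ s, f i ∈ degreeLE T R (d i)) : ∏ i ∈ s, f i ∈ degreeLE T R (∑ i ∈ s, d i) := by
  classical
  induction s using Finset.induction_on with
  | empty => simpa using one_mem_degreeLE
  | insert i s hi ih =>
    rw [Finset.prod_insert hi, Finset.sum_insert hi]
    exact mul_mem_degreeLE (hf i (by simp)) (ih fun j hj => hf j (by simp [hj]))

theorem pow_mem_degreeLE {d : ℕ} {f : Finset T → R} (hf : f ∈ degreeLE T R d) (n : ℕ) :
    f ^ n ∈ degreeLE T R (n * d) := by
  simpa using prod_mem_degreeLE (Finset.range n) (d := fun _ => d) (f := fun _ => f)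
    fun _ _ => hf

variable [Fintype T]

theorem linear_mem_degreeLE (M : T → R) :
    (fun U => ∑ a, M a * charVec R U a) ∈ degreeLE T R 1 := by
  have : (fun U : Finset T => ∑ a, M a * charVec R U a) =
      ∑ a, M a • (fun U => charVec R U a) := by
    funext U; simp
  rw [this]
  exact Submodule.sum_mem _ fun a _ => Submodule.smul_mem _ _ (charVec_mem_degreeLE a)

variable [CharP R 2]

/-- There are `2 ^ |T \ V|` sets that contain `V`. -/
theorem sum_superset (V : Finset T) :
    ∑ U : Finset T, (if V ⊆ U then (1 : R) else 0) = if V = Finset.univ then 1 else 0 := by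
  rw [← Finset.sum_filter, Finset.sum_const, nsmul_eq_mul, mul_one]
  have : (Finset.univ.filter fun U : Finset T => V ⊆ U) = Finset.Icc V Finset.univ := by
    ext U; simp
  rw [this, Finset.card_Icc_finset (Finset.subset_univ V)]
  split_ifs with h
  · subst h; simp
  · have hlt : V.card < (Finset.univ : Finset T).card :=
      Finset.card_lt_card (Finset.ssubset_univ_iff.mpr h)
    rw [Nat.cast_pow, Nat.cast_ofNat, CharTwo.two_eq_zero, zero_pow (by omega)]

/-- A polynomial of too small a degree has no term that contains all variables. -/
theorem sum_eq_zero_of_mem_degreeLE {d : ℕ} (hd : d < Fintype.card T) {f : Finset T → R}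
    (hf : f ∈ degreeLE T R d) : ∑ U, f U = 0 := by
  refine Submodule.span_induction (p := fun f _ => ∑ U, f U = 0) ?_ (by simp) ?_ ?_ hf
  · rintro _ ⟨V, hV, rfl⟩
    rw [sum_superset, if_neg]
    rintro rfl
    exact absurd hV (by simpa using hd)
  · intro f g _ _ hf hg
    simp [Finset.sum_add_distrib, hf, hg]
  · intro c f _ hf
    simp [← Finset.mul_sum, hf]

/-- Squaring a linear form does not raise its degree: it is additive in characteristic `2`, and the
variables are idempotent. -/
theorem linear_pow_mem_degreeLE (M : T → R) {m : ℕ} (hm : 2 ≤ m) :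
    (fun U => ∑ a, M a * charVec R U a) ^ m ∈ degreeLE T R (m - 1) := by
  obtain ⟨m, rfl⟩ := Nat.exists_eq_add_of_le hm
  have h2 : (fun U : Finset T => ∑ a, M a * charVec R U a) ^ 2 =
      fun U => ∑ a, M a ^ 2 * charVec R U a := by
    funext U
    rw [Pi.pow_apply, CharTwo.sum_sq]
    exact Finset.sum_congr rfl fun a _ => by rw [mul_pow, sq (charVec R U a), charVec_mul_self]
  rw [pow_add, h2]
  have h3 := mul_mem_degreeLE (linear_mem_degreeLE fun a => M a ^ 2)
    (pow_mem_degreeLE (linear_mem_degreeLE M) m)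
  rwa [show 1 + m * 1 = 2 + m - 1 by omega] at h3

end Polarization

section CoverSum

variable {T : Type*} [Fintype T] [LinearOrder T] {R : Type*} [CommRing R]

/-- The edges of the complete graph on `T`, each with its smaller end first. -/
def edges (T : Type*) [Fintype T] [LinearOrder T] : Finset (T × T) :=
  Finset.univ.filter fun e => e.1 < e.2

/-- The part of degree `2 * l`, where `d + 2 * l` is the cardinality of `T`, of the product of the
factors `1 + B a b * y a * y b` at the characteristic vector of `U`. -/
def edgeSum (B : Matrix T T R) (d : ℕ) (U : Finset T) : R :=
  ∑ E ∈ (edges T).powerset with d + 2 * E.card = Fintype.card T,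
    ∏ e ∈ E, B e.1 e.2 * (charVec R U e.1 * charVec R U e.2)

theorem edgeSum_mem_degreeLE (B : Matrix T T R) {d d' : ℕ} (h : Fintype.card T ≤ d + d') :
    edgeSum B d ∈ degreeLE T R d' := by
  have : edgeSum B d = ∑ E ∈ (edges T).powerset with d + 2 * E.card = Fintype.card T,
      ∏ e ∈ E, fun U => B e.1 e.2 * (charVec R U e.1 * charVec R U e.2) := by
    funext U; simp [edgeSum]
  rw [this]
  refine Submodule.sum_mem _ fun E hE => ?_
  have hE := (Finset.mem_filter.mp hE).2
  refine degreeLE_mono ?_ (prod_mem_degreeLE E (d := fun _ => 2) fun e _ => ?_)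
  · rw [Finset.sum_const, smul_eq_mul]
    omega
  · have h := Submodule.smul_mem _ (B e.1 e.2)
      (mul_mem_degreeLE (R := R) (charVec_mem_degreeLE e.1) (charVec_mem_degreeLE e.2))
    have h' : (B e.1 e.2 • ((fun U => charVec R U e.1) * fun U => charVec R U e.2) :
        Finset T → R) = fun U => B e.1 e.2 * (charVec R U e.1 * charVec R U e.2) := by
      funext U
      simp
    rwa [h'] at h

variable [CharP R 2]

/-- Expand the right hand side and sum over `U` first: a product of entries of the characteristic
vector survives only if all variables occur. -/
theorem coverSum_eq_sum {S : Type*} [Fintype S] (B : Matrix T T R) (M : Matrix T S R) :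
    coverSum B M = ∑ U : Finset T, (∏ s, ∑ a, M a s * charVec R U a) *
      edgeSum B (Fintype.card S) U := by
  classical
  have key : ∀ (φ : S → T) (E : Finset (T × T)),
      ∑ U : Finset T, (∏ s, charVec R U (φ s)) * ∏ e ∈ E, charVec R U e.1 * charVec R U e.2 =
        if ∀ a, (∃ s, φ s = a) ∨ ∃ e ∈ E, e.1 = a ∨ e.2 = a then 1 else 0 := by
    intro φ E
    let V : Finset T := Finset.univ.image φ ∪ (E.image Prod.fst ∪ E.image Prod.snd)
    have hV : (∀ a, (∃ s, φ s = a) ∨ ∃ e ∈ E, e.1 = a ∨ e.2 = a) ↔ V = Finset.univ := by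
      rw [Finset.eq_univ_iff_forall]
      refine forall_congr' fun a => ?_
      simp only [V, Finset.mem_union, Finset.mem_image, Finset.mem_univ, true_and, and_or_left,
        exists_or]
    simp only [hV]
    rw [← sum_superset]
    refine Finset.sum_congr rfl fun U _ => ?_
    simp only [charVec, ← ite_and, mul_ite, mul_one, mul_zero, Finset.prod_ite_zero,
      Finset.prod_const_one]
    refine if_congr ?_ rfl rfl
    simp only [V, Finset.union_subset_iff, Finset.image_subset_iff, Finset.mem_univ, true_imp_iff]
    constructor
    · rintro ⟨h1, h2⟩
      exact ⟨fun s => h2 s, fun e he => (h1 e he).2, fun e he => (h1 e he).1⟩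
    · rintro ⟨h1, h2, h3⟩
      exact ⟨fun e he => ⟨h3 e he, h2 e he⟩, fun s => h1 s⟩
  simp only [edgeSum, Finset.prod_univ_sum, Fintype.piFinset_univ, Finset.sum_mul_sum,
    Finset.prod_mul_distrib]
  rw [Finset.sum_comm]
  rw [coverSum, Finset.sum_filter, Fintype.sum_prod_type]
  refine Finset.sum_congr rfl fun φ _ => ?_
  rw [Finset.sum_comm, Finset.sum_filter]
  rw [← Finset.sum_subset (Finset.subset_univ (edges T).powerset)]
  · refine Finset.sum_congr rfl fun E hE => ?_
    have hlt : ∀ e ∈ E, e.1 < e.2 := fun e he =>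
      (Finset.mem_filter.mp (Finset.mem_powerset.mp hE he)).2
    have hsum : ∑ U : Finset T, ((∏ s, M (φ s) s) * ∏ s, charVec R U (φ s)) *
        ((∏ e ∈ E, B e.1 e.2) * ((∏ e ∈ E, charVec R U e.1) * ∏ e ∈ E, charVec R U e.2)) =
        ((∏ s, M (φ s) s) * ∏ e ∈ E, B e.1 e.2) *
          if ∀ a, (∃ s, φ s = a) ∨ ∃ e ∈ E, e.1 = a ∨ e.2 = a then 1 else 0 := by
      rw [← key, Finset.mul_sum]
      refine Finset.sum_congr rfl fun U _ => ?_
      rw [Finset.prod_mul_distrib]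
      ring
    rw [hsum]
    by_cases h1 : Fintype.card S + 2 * E.card = Fintype.card T
    · rw [if_pos h1]
      by_cases h2 : ∀ a, (∃ s, φ s = a) ∨ ∃ e ∈ E, e.1 = a ∨ e.2 = a
      · rw [if_pos h2, if_pos ⟨hlt, h1, h2⟩, mul_one]
      · rw [if_neg h2, if_neg fun h => h2 h.cover, mul_zero]
    · rw [if_neg h1, if_neg fun h => h1 h.card]
  · intro E _ hE
    rw [if_neg]
    intro h
    exact hE (Finset.mem_powerset.mpr fun e he =>
      Finset.mem_filter.mpr ⟨Finset.mem_univ _, h.lt e he⟩)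

end CoverSum

section Sieve

variable {T Z V F : Type*} [Fintype T] [LinearOrder T] [Fintype V] [DecidableEq V]
  [Field F] [CharP F 2]

/-- The weight with which the term `m` of the sieved polynomial occurs for a set `J` of projected
elements: up to sign, this is the Pfaffian of the principal submatrix on `T ∪ J ∪ supp m`. -/
noncomputable def termWeight (B : Matrix T T F) (E : Matrix T Z F) (C : Matrix T V F) (J : Finset Z)
    (m : V →₀ ℕ) : F :=
  coverSum B (Matrix.of fun a (w : {w // w ∈ J.disjSum m.support}) => Matrix.fromCols E C a w.1)

/-- The multilinear monomials of a polynomial. -/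
def multilinearSupport {V R : Type*} [Fintype V] [CommSemiring R] (P : MvPolynomial V R) :
    Finset (V →₀ ℕ) :=
  P.support.filter fun m => ∀ i, m i ≤ 1

theorem mem_multilinearSupport {V R : Type*} [Fintype V] [CommSemiring R] {P : MvPolynomial V R}
    {m : V →₀ ℕ} : m ∈ multilinearSupport P ↔ P.coeff m ≠ 0 ∧ ∀ i, m i ≤ 1 := by
  rw [multilinearSupport, Finset.mem_filter, MvPolynomial.mem_support_iff]

theorem prod_pow_eq_prod_support {V R : Type*} [Fintype V] [CommMonoid R] {m : V →₀ ℕ}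
    (hm : ∀ i, m i ≤ 1) (f : V → R) : ∏ i, f i ^ m i = ∏ i ∈ m.support, f i := by
  rw [← Finset.prod_subset (Finset.subset_univ m.support)]
  · refine Finset.prod_congr rfl fun i hi => ?_
    have h1 := hm i
    have h2 := Finsupp.mem_support_iff.mp hi
    rw [show m i = 1 by omega, pow_one]
  · intro i _ hi
    rw [Finsupp.notMem_support_iff.mp hi, pow_zero]

/-- The terms that are not multilinear have too small a degree to survive the sum over `U`. -/
theorem sum_eval_mul_edgeSum (B : Matrix T T F) (E : Matrix T Z F) (C : Matrix T V F)
    (J : Finset Z) {P : MvPolynomial V F} {k : ℕ} (hP : P.IsHomogeneous k) (x : V → F) :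
    ∑ U : Finset T, MvPolynomial.eval (fun i => (∑ a, C a i * charVec F U a) * x i) P *
        ((∏ j ∈ J, ∑ a, E a j * charVec F U a) * edgeSum B (k + J.card) U) =
      ∑ m ∈ multilinearSupport P,
        P.coeff m * termWeight B E C J m * ∏ i ∈ m.support, x i := by
  have hexp : ∀ U : Finset T,
      MvPolynomial.eval (fun i => (∑ a, C a i * charVec F U a) * x i) P *
        ((∏ j ∈ J, ∑ a, E a j * charVec F U a) * edgeSum B (k + J.card) U) =
      ∑ m ∈ P.support, P.coeff m * (∏ i, ((∑ a, C a i * charVec F U a) * x i) ^ m i) *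
        ((∏ j ∈ J, ∑ a, E a j * charVec F U a) * edgeSum B (k + J.card) U) := fun U => by
    rw [MvPolynomial.eval_eq', Finset.sum_mul]
  rw [Finset.sum_congr rfl fun U _ => hexp U, Finset.sum_comm, multilinearSupport,
    Finset.sum_filter]
  refine Finset.sum_congr rfl fun m hm => ?_
  have hdeg : ∑ i, m i = k := by
    have := hP (MvPolynomial.mem_support_iff.mp hm)
    rw [Finsupp.weight_apply, Finsupp.sum_fintype _ _ (by simp)] at this
    simpa using this
  split_ifs with hml
  · have hcard : Fintype.card {w // w ∈ J.disjSum m.support} = k + J.card := by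
      rw [Fintype.card_coe, Finset.card_disjSum, ← hdeg,
        ← Finset.sum_subset (Finset.subset_univ m.support)
          (fun i _ hi => Finsupp.notMem_support_iff.mp hi), add_comm]
      congr 1
      rw [Finset.card_eq_sum_ones]
      refine Finset.sum_congr rfl fun i hi => ?_
      have h1 := hml i
      have h2 := Finsupp.mem_support_iff.mp hi
      omega
    rw [termWeight, coverSum_eq_sum, hcard, Finset.mul_sum, Finset.sum_mul]
    refine Finset.sum_congr rfl fun U _ => ?_
    rw [prod_pow_eq_prod_support hml, Finset.prod_mul_distrib]
    have : ∏ w : {w // w ∈ J.disjSum m.support}, ∑ a, Matrix.of (fun a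
        (w : {w // w ∈ J.disjSum m.support}) => Matrix.fromCols E C a w.1) a w * charVec F U a =
        (∏ j ∈ J, ∑ a, E a j * charVec F U a) *
          ∏ i ∈ m.support, ∑ a, C a i * charVec F U a := by
      simp only [Matrix.of_apply]
      rw [Finset.prod_coe_sort (J.disjSum m.support)
        (fun w => ∑ a, Matrix.fromCols E C a w * charVec F U a), Finset.prod_disjSum]
      simp
    rw [this]
    ring
  · push Not at hml
    obtain ⟨i₀, hi₀⟩ := hml
    have hi₀ : 2 ≤ m i₀ := hi₀
    have hlin : (∏ i, (fun U => ∑ a, C a i * charVec F U a) ^ m i : Finset T → F) ∈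
        degreeLE T F (∑ i, if i = i₀ then m i - 1 else m i) := by
      refine prod_mem_degreeLE _ fun i _ => ?_
      split_ifs with h
      · subst h
        exact linear_pow_mem_degreeLE _ hi₀
      · simpa using pow_mem_degreeLE (linear_mem_degreeLE fun a => C a i) (m i)
    have hsum : (∑ i, if i = i₀ then m i - 1 else m i) + 1 = k := by
      have h1 : ∑ i ∈ Finset.univ.erase i₀, m i + m i₀ = ∑ i, m i :=
        Finset.sum_erase_add _ (fun i => m i) (Finset.mem_univ i₀)
      have h2 : ∑ i ∈ Finset.univ.erase i₀, (if i = i₀ then m i - 1 else m i) =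
          ∑ i ∈ Finset.univ.erase i₀, m i :=
        Finset.sum_congr rfl fun i hi => if_neg (Finset.ne_of_mem_erase hi)
      rw [← Finset.sum_erase_add _ _ (Finset.mem_univ i₀), if_pos rfl, h2]
      omega
    have hJ : (∏ j ∈ J, fun U => ∑ a, E a j * charVec F U a : Finset T → F) ∈
        degreeLE T F J.card := by
      have := prod_mem_degreeLE J (d := fun _ => 1) fun j _ => linear_mem_degreeLE fun a => E a j
      simpa using this
    by_cases hc : k + J.card ≤ Fintype.card T
    · have h := mul_mem_degreeLE hlin (mul_mem_degreeLE hJ (edgeSum_mem_degreeLE B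
        (d := k + J.card) (d' := Fintype.card T - (k + J.card)) (by omega)))
      have h0 := sum_eq_zero_of_mem_degreeLE (by omega) h
      have : ∀ U : Finset T, P.coeff m * (∏ i, ((∑ a, C a i * charVec F U a) * x i) ^ m i) *
          ((∏ j ∈ J, ∑ a, E a j * charVec F U a) * edgeSum B (k + J.card) U) =
          (P.coeff m * ∏ i, x i ^ m i) * ((∏ i, (fun U => ∑ a, C a i * charVec F U a) ^ m i) *
            ((∏ j ∈ J, fun U => ∑ a, E a j * charVec F U a) *
              edgeSum B (k + J.card)) : Finset T → F) U := by
        intro U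
        simp only [mul_pow, Finset.prod_mul_distrib, Pi.mul_apply, Finset.prod_apply, Pi.pow_apply]
        ring
      rw [Finset.sum_congr rfl fun U _ => this U, ← Finset.mul_sum, h0, mul_zero]
    · refine Finset.sum_eq_zero fun U _ => ?_
      rw [edgeSum, Finset.sum_eq_zero, mul_zero, mul_zero]
      intro E hE
      have := (Finset.mem_filter.mp hE).2
      omega

end Sieve

/-! ### Sparse representations -/

section SparseRep

theorem isSkew_fromBlocks {T R : Type*} [CommRing R] {B : Matrix T T R} (hB : IsSkew B) {W : Type*} (M : Matrix T W R) :
    IsSkew (Matrix.fromBlocks B M (-Mᵀ) 0) := by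
  refine ⟨?_, ?_⟩
  · rw [Matrix.fromBlocks_transpose, Matrix.fromBlocks_neg, hB.1]
    simp
  · rintro (i | i)
    · exact hB.2 i
    · rfl

theorem IsSkew.submatrix {R ι κ : Type*} [CommRing R] {A : Matrix ι ι R} (hA : IsSkew A) (f : κ → ι) :
    IsSkew (A.submatrix f f) :=
  ⟨by rw [Matrix.transpose_submatrix, hA.1]; rfl, fun i => hA.2 (f i)⟩

variable {T S : Type*} [Fintype T] [LinearOrder T] [Fintype S] {R : Type*} [CommRing R] [CharP R 2]

theorem coverSum_reindex {S' : Type*} [Fintype S'] (B : Matrix T T R) (M : Matrix T S R)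
    (e : S' ≃ S) : coverSum B (M.submatrix id e) = coverSum B M := by
  rw [coverSum_eq_sum, coverSum_eq_sum, Fintype.card_congr e]
  refine Finset.sum_congr rfl fun U _ => ?_
  congr 1
  exact Fintype.prod_equiv e _ _ fun s => rfl

theorem coverSum_sq [DecidableEq S] {B : Matrix T T R} (hB : IsSkew B) (M : Matrix T S R) :
    coverSum B M ^ 2 = (Matrix.fromBlocks B M (-Mᵀ) 0).det := by
  let : LinearOrder S := LinearOrder.lift' (Fintype.equivFin S) (Fintype.equivFin S).injective
  have h := pfaffian_eq_coverSum (ι := T ⊕ₗ S) (B := B) (M := M)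
    (A := (Matrix.fromBlocks B M (-Mᵀ) 0).submatrix ofLex ofLex) toLex
    (fun a b => Sum.Lex.inl_lt_inl_iff) (fun a s => Sum.Lex.inl_lt_inr _ _)
    (fun a b => rfl) (fun a s => rfl) (fun s s' => rfl)
  rw [← h, pfaffian_sq ((isSkew_fromBlocks hB M).submatrix _),
    ← Matrix.det_submatrix_equiv_self (ofLex : T ⊕ₗ S ≃ T ⊕ S)]
  congr!

end SparseRep

section Field

theorem sievedPolynomial_eq_sum {T V F : Type*} [Fintype T] [LinearOrder T] [Field F] [Fintype V]
    [LinearOrder V] (B : Matrix T T F) (C : Matrix T V F) (P : MvPolynomial V F) :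
    sievedPolynomial B C P = ∑ m ∈ multilinearSupport P, MvPolynomial.monomial m
      (P.coeff m * pfaffianOn (sparseMatrix B C) (Finset.univ.disjSum m.support)) :=
  rfl

variable {T W F : Type*} [Fintype T] [LinearOrder T] [Field F] [CharP F 2]

/-- The index set of a principal submatrix that contains all of `T`. -/
def disjSumEquiv (S : Finset W) :
    T ⊕ {w // w ∈ S} ≃ {i : T ⊕ W // i ∈ Finset.univ.disjSum S} where
  toFun := Sum.elim (fun a => ⟨.inl a, by simp⟩) (fun w => ⟨.inr w.1, by simp⟩)
  invFun i := match i with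
    | ⟨.inl a, _⟩ => .inl a
    | ⟨.inr w, h⟩ => .inr ⟨w, by simpa using h⟩
  left_inv := by rintro (a | w) <;> rfl
  right_inv := by rintro ⟨a | w, h⟩ <;> rfl

theorem disjSum_mem_nonsingularSets [DecidableEq W] {B : Matrix T T F} (hB : IsSkew B)
    (M : Matrix T W F) (S : Finset W) :
    Finset.univ.disjSum S ∈ nonsingularSets (sparseMatrix B M) ↔
      coverSum B (Matrix.of fun a (w : {w // w ∈ S}) => M a w.1) ≠ 0 := by
  rw [← pow_ne_zero_iff (n := 2) two_ne_zero, coverSum_sq hB, nonsingularSets, Set.mem_ofPred_eq,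
    ← Matrix.det_submatrix_equiv_self (disjSumEquiv S)]
  refine not_congr (Eq.congr ?_ rfl)
  congr 1
  ext (i | i) (j | j) <;> rfl

theorem pfaffianOn_eq_coverSum [LinearOrder W] (B : Matrix T T F) (M : Matrix T W F)
    (S : Finset W) :
    pfaffianOn (sparseMatrix B M) (Finset.univ.disjSum S) =
      coverSum B (Matrix.of fun a (w : {w // w ∈ S}) => M a w.1) := by
  let _ : Fintype {i : T ⊕ₗ W // ofLex i ∈ Finset.univ.disjSum S} :=
    Fintype.ofEquiv {i : T ⊕ W // i ∈ Finset.univ.disjSum S}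
      (toLex.subtypeEquiv (fun _ => Iff.rfl))
  let e : T ⊕ {w // w ∈ S} ≃ {i : T ⊕ₗ W // ofLex i ∈ Finset.univ.disjSum S} :=
    (disjSumEquiv S).trans (toLex.subtypeEquiv (fun _ => Iff.rfl))
  exact pfaffian_eq_coverSum e (fun a b => Sum.Lex.inl_lt_inl_iff)
    (fun a s => Sum.Lex.inl_lt_inr _ _) (fun a b => rfl) (fun a s => rfl) (fun s s' => rfl)

theorem termWeight_ne_zero_iff {Z V : Type*} [DecidableEq Z] [DecidableEq V] {B : Matrix T T F}
    (hB : IsSkew B) (E : Matrix T Z F) (C : Matrix T V F) (J : Finset Z) (m : V →₀ ℕ) :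
    termWeight B E C J m ≠ 0 ↔ Finset.univ.disjSum (J.disjSum m.support) ∈
      nonsingularSets (sparseMatrix B (Matrix.fromCols E C)) :=
  (disjSum_mem_nonsingularSets hB _ _).symm

theorem termWeight_of_isEmpty {Z V : Type*} [IsEmpty Z] [LinearOrder V] (B : Matrix T T F)
    (E : Matrix T Z F) (C : Matrix T V F) (m : V →₀ ℕ) :
    termWeight B E C ∅ m = pfaffianOn (sparseMatrix B C) (Finset.univ.disjSum m.support) := by
  rw [pfaffianOn_eq_coverSum, termWeight]
  let e : {v // v ∈ m.support} ≃ {w : Z ⊕ V // w ∈ (∅ : Finset Z).disjSum m.support} :=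
    (Equiv.emptySum Z V).symm.subtypeEquiv (by simp)
  rw [← coverSum_reindex _ _ e]
  congr 1

end Field

/-! ### The value computed by the programs -/

section Value

open Polynomial

variable {F : Type*} [Field F] {t p n : ℕ}

theorem prod_edges (f : ℕ → ℕ → F[X][X]) :
    ∏ i ∈ Finset.range t, ∏ j ∈ Finset.range i, f j i = ∏ e ∈ edges (Fin t), f e.1 e.2 := by
  rw [Finset.prod_sigma']
  refine Finset.prod_bij' (fun q hq => (⟨q.2, ?_⟩, ⟨q.1, ?_⟩)) (fun e _ => ⟨e.2, e.1⟩)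
    ?_ ?_ ?_ ?_ ?_
  · simp only [Finset.mem_sigma, Finset.mem_range] at hq; omega
  · simp only [Finset.mem_sigma, Finset.mem_range] at hq; omega
  · intro q hq
    simp only [Finset.mem_sigma, Finset.mem_range] at hq
    simpa [edges] using hq.2
  · intro e he
    simp only [edges, Finset.mem_filter, Finset.mem_univ, true_and] at he
    simpa using he
  · intro q _; rfl
  · intro e _; rfl
  · intro q _; rfl

/-- The polynomial with the coefficients `c v`, `v < d`. -/
noncomputable def digitPoly (d : ℕ) (c : ℕ → F) : F[X] := ∑ v ∈ Finset.range d, C (c v) * X ^ v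

theorem reversedCoeff_weightPoly (d k : ℕ) (B E Z : ℕ → ℕ → F) (u : ℕ → F) (U : Finset (Fin t))
    (hu : ∀ a : Fin t, u a = charVec F U a) :
    reversedCoeff t (weightPoly t p d B E Z u) k = ∑ J : Finset (Fin p),
      (∏ j ∈ J, digitPoly d (Z j)) * C ((∏ j ∈ J, ∑ a : Fin t, E a j * charVec F U a) *
        edgeSum (Matrix.of fun i j : Fin t => B i j) (k + J.card) U) := by
  have hw : weightPoly t p d B E Z u = ∑ J : Finset (Fin p), ∑ S ∈ (edges (Fin t)).powerset,
      C ((∏ j ∈ J, digitPoly d (Z j)) * C ((∏ j ∈ J, ∑ a : Fin t, E a j * charVec F U a) *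
        ∏ e ∈ S, B e.1 e.2 * (charVec F U e.1 * charVec F U e.2))) *
        X ^ (J.card + 2 * S.card) := by
    have h1 : ∀ j, ∑ a ∈ Finset.range t, E a j * u a = ∑ a : Fin t, E a j * charVec F U a := by
      intro j
      rw [Finset.sum_range]
      exact Finset.sum_congr rfl fun a _ => by rw [hu]
    unfold weightPoly
    simp only [h1]
    rw [prod_edges fun j i => (1 + C (C (B j i * (u j * u i))) * X ^ 2 : F[X][X]),
      Finset.prod_range fun j => (1 + C (C (∑ a : Fin t, E a j * charVec F U a) *
        ∑ v ∈ Finset.range d, C (Z j v) * X ^ v) * X ^ 1 : F[X][X]),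
      Finset.prod_one_add, Finset.prod_one_add, Finset.powerset_univ, Finset.sum_mul_sum]
    refine Finset.sum_congr rfl fun J _ => Finset.sum_congr rfl fun S _ => ?_
    rw [Finset.prod_mul_distrib, Finset.prod_mul_distrib, Finset.prod_const, Finset.prod_const,
      ← map_prod, ← map_prod, ← map_prod, Finset.prod_mul_distrib, ← map_prod, pow_add, pow_mul,
      pow_one]
    simp only [hu, digitPoly, map_mul]
    ring
  rw [hw, reversedCoeff]
  simp only [finsetSum_coeff, coeff_C_mul, coeff_X_pow, edgeSum, Finset.sum_filter,
    Fintype.card_fin]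
  by_cases hk : k ≤ t
  · rw [if_pos hk]
    refine Finset.sum_congr rfl fun J _ => ?_
    rw [Finset.mul_sum, map_sum, Finset.mul_sum]
    refine Finset.sum_congr rfl fun S _ => ?_
    have : (t - k = J.card + 2 * S.card) = (k + J.card + 2 * S.card = t) :=
      propext ⟨fun _ => by omega, fun _ => by omega⟩
    simp only [this]
    split_ifs <;> simp
  · rw [if_neg hk]
    symm
    refine Finset.sum_eq_zero fun J _ => ?_
    rw [Finset.sum_eq_zero, mul_zero, map_zero, mul_zero]
    intro S _
    rw [if_neg (by omega)]

/-- The numbers below `2 ^ t` correspond to the subsets of `Fin t` through their binary digits. -/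
theorem sum_range_two_pow {M : Type*} [AddCommMonoid M] (f : ℕ → M) (g : Finset (Fin t) → M)
    (h : ∀ m < 2 ^ t, f m = g (Finset.univ.filter fun a : Fin t => m.testBit a)) :
    ∑ m ∈ Finset.range (2 ^ t), f m = ∑ U, g U := by
  have hinj : Set.InjOn (fun m => Finset.univ.filter fun a : Fin t => m.testBit a)
      (Finset.range (2 ^ t) : Set ℕ) := by
    intro m hm m' hm' heq
    have hm := Finset.mem_range.mp hm
    have hm' := Finset.mem_range.mp hm'
    refine Nat.eq_of_testBit_eq fun a => ?_
    by_cases ha : a < t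
    · have h1 := Finset.ext_iff.mp heq ⟨a, ha⟩
      simp only [Finset.mem_filter, Finset.mem_univ, true_and] at h1
      exact Bool.eq_iff_iff.mpr h1
    · rw [Nat.testBit_lt_two_pow (hm.trans_le (Nat.pow_le_pow_right two_pos (not_lt.mp ha))),
        Nat.testBit_lt_two_pow (hm'.trans_le (Nat.pow_le_pow_right two_pos (not_lt.mp ha)))]
  have himg : (Finset.range (2 ^ t)).image
      (fun m => Finset.univ.filter fun a : Fin t => m.testBit a) = Finset.univ := by
    refine Finset.eq_univ_of_card _ ?_
    rw [Finset.card_image_of_injOn hinj, Finset.card_range, Fintype.card_finset,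
      Fintype.card_fin]
  rw [← himg, Finset.sum_image hinj]
  exact Finset.sum_congr rfl fun m hm => h m (Finset.mem_range.mp hm)

/-- The sum computed by the programs is the sieved polynomial, with the variables of the projected
elements replaced by the polynomials with the coefficients in array `4`. -/
theorem partialSum_eq [CharP F 2] {k : ℕ} {P : MvPolynomial (Fin n) F} (hP : P.IsHomogeneous k)
    (d : ℕ) (B : Matrix (Fin t) (Fin t) F) (E : Matrix (Fin t) (Fin p) F)
    (C' : Matrix (Fin t) (Fin n) F) (x : Fin n → F) (A : ℕ → ℕ → ℕ → F)
    (hB : ∀ i j : Fin t, A 0 i j = B i j) (hE : ∀ i j, A 1 (i : Fin t) (j : Fin p) = E i j)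
    (hC : ∀ i j, A 2 (i : Fin t) (j : Fin n) = C' i j) (hx : ∀ i : Fin n, A 3 0 i = x i) :
    partialSum (blackBox P) t p k d A (2 ^ t) = ∑ J : Finset (Fin p),
      (∏ j ∈ J, digitPoly d (A 4 j)) * C (∑ m ∈ multilinearSupport P,
        P.coeff m * termWeight B E C' J m * ∏ i ∈ m.support, x i) := by
  rw [partialSum, sum_range_two_pow (g := fun U => ∑ J : Finset (Fin p),
      (∏ j ∈ J, digitPoly d (A 4 j)) * C (MvPolynomial.eval
        (fun i => (∑ a, C' a i * charVec F U a) * x i) P *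
        ((∏ j ∈ J, ∑ a, E a j * charVec F U a) * edgeSum B (k + J.card) U)))]
  · rw [Finset.sum_comm]
    refine Finset.sum_congr rfl fun J _ => ?_
    rw [← sum_eval_mul_edgeSum B E C' J hP x, map_sum, Finset.mul_sum]
  · intro m _
    set U := Finset.univ.filter fun a : Fin t => m.testBit a with hU
    have hu : ∀ a : Fin t, bits F m a = charVec F U a := by
      intro a
      simp [bits, charVec, hU]
    rw [reversedCoeff_weightPoly d k _ _ _ _ U hu, Finset.mul_sum]
    refine Finset.sum_congr rfl fun J _ => ?_
    have h1 : blackBox P (queryPoint t (A 2) (A 3) (bits F m)) =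
        MvPolynomial.eval (fun i => (∑ a, C' a i * charVec F U a) * x i) P := by
      unfold blackBox queryPoint
      congr 2
      funext i
      rw [Finset.sum_range, Finset.sum_mul]
      simp only [hC, hx, hu]
    have h2 : (Matrix.of fun i j : Fin t => A 0 i j) = B := by
      ext i j; exact hB i j
    rw [h1, h2]
    simp only [hE, C_mul]
    ring

end Value

/-! ### The evaluator and the sieve -/

/-- Computes the sieved polynomial at the given point. -/
def Prog.evaluator : Prog :=
  .seq .widths (.seq .sumSubsets
    (.setF 0 (.lit 0) (.lit 0) (.get 8 (.lit 0) (.lit 0))))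

/-- Draws a random point. -/
def Prog.drawPoint : Prog := .forTo 3 (.get 0 (.lit 0)) (.rand 3 (.lit 0) (.var 3))

/-- Draws the coefficients of a random polynomial for every projected element. -/
def Prog.drawDigits : Prog :=
  .forTo 3 (.get 0 (.lit 2)) (.forTo 4 (.var 2) (.rand 4 (.var 3) (.var 4)))

/-- Tests whether one of the coefficients in array `8` is non-zero. -/
def Prog.testNonzero : Prog :=
  .seq (.setI 0 (.lit 0) (.lit 0)) (.forTo 7 (.var 1)
    (.cond (.not (.isZero (.get 8 (.lit 0) (.var 7)))) (.setI 0 (.lit 0) (.lit 1)) .nop))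

/-- Tests whether the sieved polynomial is non-zero at a random point. -/
def Prog.sieve : Prog :=
  .seq .drawPoint (.seq .widths (.seq .drawDigits (.seq .sumSubsets .testNonzero)))

section Programs

open Polynomial

variable {F : Type*} [Field F] {o : (ℕ → F) → F} {n t p k : ℕ}

theorem drawPoint_spec {s : Store F} (hn : s.int 0 0 = n) :
    HaltsWithin o .drawPoint s (n * (1 + 2) + 2) (fun s' =>
      (∀ i < n, s'.fld 3 0 i = s.tape i) ∧ s'.tape = fun i => s.tape (i + n)) := by
  refine HaltsWithin.forTo (fun m s' => (∀ i < m, s'.fld 3 0 i = s.tape i) ∧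
    s'.tape = fun i => s.tape (i + m)) (by decide) ?_ (by simp) ?_
  · intro s' hu
    rw [IExp.eval, hu.int 0 (by decide)]
    exact hn
  · rintro i hi s' hu h3 ⟨h1, h2⟩
    refine HaltsWithin.rand ⟨fun j hj => ?_, ?_⟩
    · simp only [IExp.eval, h3, Store.setI_fld, Store.advance, Store.setF_fld_self,
        Function.update_self, h2, zero_add]
      by_cases hji : j = i
      · subst hji; simp
      · rw [Function.update_of_ne hji, h1 j (by omega)]
    · funext j
      simp only [Store.setI_tape, Store.advance, Store.setF_tape, h2]
      congr 1
      omega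

theorem drawDigits_spec {s : Store F} {W d : ℕ} (hP : Params s n t p k W d) :
    HaltsWithin o .drawDigits s (p * ((d * (1 + 2) + 2) + 2) + 2) (fun s' =>
      ∀ j < p, ∀ v < d, s'.fld 4 j v = s.tape (j * d + v)) := by
  refine (HaltsWithin.forTo (M := p) (K := d * (1 + 2) + 2) (fun m s' =>
    (∀ j < m, ∀ v < d, s'.fld 4 j v = s.tape (j * d + v)) ∧
    s'.tape = fun i => s.tape (i + m * d)) (by decide) ?_ (by simp) ?_).mono le_rfl
    (fun _ h => h.1)
  · intro s' hu
    rw [IExp.eval, hu.int 0 (by decide)]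
    exact hP.hp
  · rintro j hj s' hu h3 ⟨h1, h2⟩
    refine (HaltsWithin.forTo (M := d) (K := 1) (fun m s' =>
      (∀ j' < j, ∀ v < d, s'.fld 4 j' v = s.tape (j' * d + v)) ∧
      (∀ v < m, s'.fld 4 j v = s.tape (j * d + v)) ∧
      s'.tape = fun i => s.tape (i + (j * d + m))) (by decide) ?_ ?_ ?_).mono le_rfl ?_
    · intro s'' hu'
      rw [IExp.eval, hu'.int 2 (by decide), hu.int 2 (by decide)]
      exact hP.hd
    · exact ⟨h1, by simp, by simpa using h2⟩
    · rintro v hv s'' hu' h4 ⟨g1, g2, g3⟩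
      have e3 : s''.int 3 0 = j := by rw [hu'.int 3 (by decide), h3]
      refine HaltsWithin.rand ⟨fun j' hj' v' hv' => ?_, fun v' hv' => ?_, ?_⟩
      · simp only [IExp.eval, e3, Store.setI_fld, Store.advance, Store.setF_fld_self]
        rw [Function.update_of_ne hj'.ne, g1 j' hj' v' hv']
      · simp only [IExp.eval, e3, h4, Store.setI_fld, Store.advance, Store.setF_fld_self,
          Function.update_self, g3, zero_add]
        by_cases h : v' = v
        · subst h; simp
        · rw [Function.update_of_ne h, g2 v' (by omega)]
      · funext i
        simp only [Store.setI_tape, Store.advance, Store.setF_tape, g3]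
        congr 1
        omega
    · rintro r ⟨g1, g2, g3⟩
      refine ⟨fun j' hj' v hv => ?_, ?_⟩
      · rcases Nat.lt_succ_iff_lt_or_eq.mp hj' with h | rfl
        · exact g1 j' h v hv
        · exact g2 v hv
      · rw [Store.setI_tape, g3, Nat.succ_mul]

theorem testNonzero_spec {s : Store F} {W : ℕ} (hW : s.int 1 0 = W) :
    HaltsWithin o .testNonzero s (1 + (W * ((1 + 1) + 2) + 2)) (fun s' =>
      ((∃ x < W, s.fld 8 0 x ≠ 0) → s'.outI = 1) ∧
      ((∀ x < W, s.fld 8 0 x = 0) → s'.outI = 0)) := by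
  refine (HaltsWithin.setI (R := fun s' => s' = s.setI 0 0 0) rfl).seq ?_
  rintro s₁ - rfl
  refine HaltsWithin.forTo (fun m s' => ((∃ x < m, s.fld 8 0 x ≠ 0) → s'.outI = 1) ∧
      ((∀ x < m, s.fld 8 0 x = 0) → s'.outI = 0)) (by decide) ?_ ?_ ?_
  · intro s' hu
    rw [IExp.eval, hu.int 1 (by decide)]
    simp [Store.setI_int_ne, IExp.eval, hW]
  · exact ⟨by simp, by simp [Store.outI, Store.setI_int_ne]⟩
  · rintro x hx s' hu h7 ⟨h1, h2⟩
    have hf : s'.fld 8 = s.fld 8 := by rw [hu.fld 8 (by decide)]; rfl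
    refine HaltsWithin.cond (fun h => HaltsWithin.setI ⟨fun _ => ?_, fun h' => ?_⟩)
      (fun h => HaltsWithin.nop ⟨?_, fun h' => ?_⟩)
    · simp [Store.outI, Store.setI_int_ne, IExp.eval]
    · simp only [Test.Holds, FExp.eval, IExp.eval, h7, hf] at h
      exact absurd (h' x (Nat.lt_succ_self x)) h
    · rintro ⟨y, hy, hy'⟩
      simp only [Test.Holds, FExp.eval, IExp.eval, h7, hf, not_not] at h
      have : y ≠ x := by rintro rfl; exact hy' h
      simpa [Store.outI, Store.setI_int_ne] using h1 ⟨y, by omega, hy'⟩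
    · simpa [Store.outI, Store.setI_int_ne] using h2 fun y hy => h' y (by omega)

theorem blackBox_congr (P : MvPolynomial (Fin n) F) (v v' : ℕ → F) (h : ∀ i < n, v i = v' i) :
    blackBox P v = blackBox P v' := by
  unfold blackBox
  congr 2
  funext i
  exact h i i.2

theorem matrixArray_apply {a b : ℕ} (M : Matrix (Fin a) (Fin b) F) (i : Fin a) (j : Fin b) :
    matrixArray M i j = M i j := by
  simp [matrixArray]

/-- The value of the sieved polynomial of a projected representation, at a point with coordinates
`x` in the field for the elements and polynomials `z` for the projected elements. -/
noncomputable def sieveValue (B : Matrix (Fin t) (Fin t) F) (E : Matrix (Fin t) (Fin p) F)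
    (C' : Matrix (Fin t) (Fin n) F) (P : MvPolynomial (Fin n) F) (x : Fin n → F)
    (z : Fin p → F[X]) : F[X] :=
  ∑ J : Finset (Fin p), (∏ j ∈ J, z j) * C (∑ m ∈ multilinearSupport P,
    P.coeff m * termWeight B E C' J m * ∏ i ∈ m.support, x i)

theorem natDegree_digitPoly_le (d : ℕ) (c : ℕ → F) : (digitPoly (d + 1) c).natDegree ≤ d := by
  refine natDegree_sum_le_of_forall_le _ _ fun v hv => ?_
  exact (natDegree_C_mul_X_pow_le _ _).trans (Nat.lt_succ_iff.mp (Finset.mem_range.mp hv))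

theorem natDegree_sieveValue_le (B : Matrix (Fin t) (Fin t) F) (E : Matrix (Fin t) (Fin p) F)
    (C' : Matrix (Fin t) (Fin n) F) (P : MvPolynomial (Fin n) F) (x : Fin n → F)
    {z : Fin p → F[X]} {d : ℕ} (hz : ∀ j, (z j).natDegree ≤ d) :
    (sieveValue B E C' P x z).natDegree ≤ p * d := by
  refine natDegree_sum_le_of_forall_le _ _ fun J _ => ?_
  refine (natDegree_mul_C_le _ _).trans ((natDegree_prod_le _ _).trans ?_)
  refine (Finset.sum_le_card_nsmul _ _ d fun j _ => hz j).trans ?_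
  rw [smul_eq_mul]
  gcongr
  exact card_finset_fin_le J

variable [CharP F 2]

/-- An upper bound for the running time of `Prog.evaluator`. -/
def evaluatorTime (n t p : ℕ) : ℕ :=
  (1 + (1 + (p * (((p + 3) * (1 + 2) + 2) + 2) + 2))) +
    ((2 ^ t * (passTime n t p (p * (p + 3) + 1) (p + 3) + 1) + 1) + 1)

theorem evaluator_spec (B : Matrix (Fin t) (Fin t) F) (C' : Matrix (Fin t) (Fin n) F)
    {P : MvPolynomial (Fin n) F} (hP : P.IsHomogeneous k) (x : Fin n → F) (tape : ℕ → F) :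
    HaltsWithin (blackBox P) .evaluator
      (inputStore k B (0 : Matrix (Fin t) (Fin 0) F) C' x tape) (evaluatorTime n t 0)
      (fun s => s.outF = MvPolynomial.eval x (sievedPolynomial B C' P)) := by
  set s := inputStore k B (0 : Matrix (Fin t) (Fin 0) F) C' x tape with hs
  refine (widths_spec (s := s) (n := n) (t := t) (p := 0) (k := k) rfl rfl rfl rfl).seq ?_
  intro s₁ hu₁ hP₁
  have hf : s₁.fld = s.fld := funext fun a => hu₁.fld a (by
    have : Prog.widths.fldWrites = [] := rfl
    simp [this])
  refine (sumSubsets_spec (blackBox_congr P) hP₁ ?_ ?_ ?_ ?_).seq ?_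
  · intro l _ x _; rw [hf]; rfl
  · intro a _; rw [hf]; rfl
  · intro x _; rw [hf]; rfl
  · rw [hf]; rfl
  · intro s₂ hu₂ h8
    refine HaltsWithin.setF ?_
    simp only [Store.outF, IExp.eval, FExp.eval, Store.setF_fld_self, Function.update_self]
    rw [h8 0 (by omega), hf, partialSum_eq hP _ B (0 : Matrix (Fin t) (Fin 0) F) C' x s.fld
      (matrixArray_apply B) (fun i j => j.elim0) (matrixArray_apply C')
      (matrixArray_apply (Matrix.of (fun (_ : Fin 1) => x)) 0)]
    have : (default : Finset (Fin 0)) = ∅ := rfl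
    rw [Fintype.sum_unique, this, Finset.prod_empty, one_mul, coeff_C_zero,
      sievedPolynomial_eq_sum, map_sum]
    refine Finset.sum_congr rfl fun m hm => ?_
    rw [termWeight_of_isEmpty, MvPolynomial.eval_monomial, Finsupp.prod_fintype _ _ (by simp),
      prod_pow_eq_prod_support (mem_multilinearSupport.mp hm).2]

/-- An upper bound for the running time of `Prog.sieve`. -/
def sieveTime (n t p : ℕ) : ℕ :=
  (n * (1 + 2) + 2) + ((1 + (1 + (p * (((p + 3) * (1 + 2) + 2) + 2) + 2))) +
    ((p * (((p + 3) * (1 + 2) + 2) + 2) + 2) +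
    ((2 ^ t * (passTime n t p (p * (p + 3) + 1) (p + 3) + 1) + 1) +
      (1 + ((p * (p + 3) + 1) * ((1 + 1) + 2) + 2)))))

theorem sieve_spec (B : Matrix (Fin t) (Fin t) F) (E : Matrix (Fin t) (Fin p) F)
    (C' : Matrix (Fin t) (Fin n) F) {P : MvPolynomial (Fin n) F} (hP : P.IsHomogeneous k)
    (tape : ℕ → F) {v : F[X]} (hv : v = sieveValue B E C' P (fun i => tape i) (fun j =>
      digitPoly (p + 3) fun v => tape (j * (p + 3) + v + n))) :
    HaltsWithin (blackBox P) .sieve (inputStore k B E C' 0 tape) (sieveTime n t p)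
      (fun s => (v ≠ 0 → s.outI = 1) ∧ (v = 0 → s.outI = 0)) := by
  set s := inputStore k B E C' 0 tape with hs
  refine (drawPoint_spec (s := s) (n := n) rfl).seq ?_
  rintro s₁ hu₁ ⟨h1, h1'⟩
  have hi1 : s₁.int 0 = s.int 0 := hu₁.int 0 (by decide)
  refine (widths_spec (s := s₁) (n := n) (t := t) (p := p) (k := k) ?_ ?_ ?_ ?_).seq ?_
  · rw [hi1]; rfl
  · rw [hi1]; rfl
  · rw [hi1]; rfl
  · rw [hi1]; rfl
  intro s₂ hu₂ hP₂
  have ht2 : s₂.tape = fun i => tape (i + n) := (hu₂.tape (by decide)).trans h1'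
  refine (drawDigits_spec hP₂).seq ?_
  intro s₃ hu₃ h3
  have hP₃ : Params s₃ n t p k _ _ :=
    hP₂.congr (hu₃.int 0 (by decide)) (hu₃.int 1 (by decide)) (hu₃.int 2 (by decide))
  have hf2 : s₂.fld = s₁.fld := funext fun a => hu₂.fld a (by
    have : Prog.widths.fldWrites = [] := rfl
    simp [this])
  have hf : ∀ a, a ≠ 3 → a ≠ 4 → s₃.fld a = s.fld a := by
    intro a ha ha'
    have h4 : Prog.drawDigits.fldWrites = [4] := rfl
    have h3 : Prog.drawPoint.fldWrites = [3] := rfl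
    rw [hu₃.fld a (by simp [h4, ha']), hf2, hu₁.fld a (by simp [h3, ha])]
  have hf3 : ∀ i < n, s₃.fld 3 0 i = tape i := by
    intro i hi
    rw [hu₃.fld 3 (by decide), hf2, h1 i hi]; rfl
  refine (sumSubsets_spec (blackBox_congr P) hP₃ ?_ ?_ ?_ ?_).seq ?_
  · intro l _ x _; rw [hf 7 (by decide) (by decide)]; rfl
  · intro a _; rw [hf 5 (by decide) (by decide)]; rfl
  · intro x _; rw [hf 8 (by decide) (by decide)]; rfl
  · rw [hf 10 (by decide) (by decide)]; rfl
  intro s₄ hu₄ h8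
  have hval : partialSum (blackBox P) t p k (p + 3) s₃.fld (2 ^ t) = v := by
    rw [partialSum_eq hP _ B E C' (fun i => tape i) s₃.fld, hv, sieveValue]
    · refine Finset.sum_congr rfl fun J _ => ?_
      congr 1
      refine Finset.prod_congr rfl fun j _ => ?_
      refine Finset.sum_congr rfl fun v hv => ?_
      rw [h3 j j.2 v (Finset.mem_range.mp hv), ht2]
    · intro i j; rw [hf 0 (by decide) (by decide)]; exact matrixArray_apply B i j
    · intro i j; rw [hf 1 (by decide) (by decide)]; exact matrixArray_apply E i j
    · intro i j; rw [hf 2 (by decide) (by decide)]; exact matrixArray_apply C' i j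
    · intro i; exact hf3 i i.2
  rw [hval] at h8
  have hdeg : v.natDegree ≤ p * (p + 3) := by
    rw [hv]
    refine natDegree_sieveValue_le _ _ _ _ _ fun j => ?_
    exact (natDegree_digitPoly_le _ _).trans (by omega)
  refine (testNonzero_spec ((congrFun (hu₄.int 1 (by decide)) 0).trans hP₃.hW)).mono le_rfl ?_
  rintro r ⟨r1, r2⟩
  refine ⟨fun h => r1 ?_, fun h => r2 ?_⟩
  · refine ⟨v.natDegree, by omega, ?_⟩
    rw [h8 _ (by omega)]
    exact leadingCoeff_ne_zero.mpr h
  · intro x hx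
    rw [h8 x hx, h, coeff_zero]

end Programs

section Time

theorem passTime_le {n t p L : ℕ} (hL : L = n + t + p + 1) :
    passTime n t p (p * (p + 3) + 1) (p + 3) ≤ 1000 * L ^ 5 := by
  have hn : n ≤ L := by omega
  have ht : t ≤ L := by omega
  have hp : p ≤ L := by omega
  have h1 : 1 ≤ L := by omega
  have hd : p + 3 ≤ 3 * L := by omega
  have hW : p * (p + 3) + 1 ≤ 2 * L ^ 2 := by
    obtain ⟨M, rfl⟩ := Nat.exists_eq_add_of_le (show p + 1 ≤ L by omega)
    nlinarith
  have hmono : passTime n t p (p * (p + 3) + 1) (p + 3) ≤ passTime L L L (2 * L ^ 2) (3 * L) := by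
    unfold passTime factorsTime
    gcongr
  refine hmono.trans ?_
  have e1 : L ≤ L ^ 5 := Nat.le_self_pow (by norm_num) L
  have e2 : L ^ 2 ≤ L ^ 5 := Nat.pow_le_pow_right h1 (by norm_num)
  have e3 : L ^ 3 ≤ L ^ 5 := Nat.pow_le_pow_right h1 (by norm_num)
  have e4 : L ^ 4 ≤ L ^ 5 := Nat.pow_le_pow_right h1 (by norm_num)
  unfold passTime factorsTime
  ring_nf
  linarith

theorem sieveTime_le_timeBound {c n t p r : ℕ} (hc : 2202 ≤ c) (h : t ≤ r + 1) :
    sieveTime n t p ≤ timeBound c n t p r := by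
  obtain ⟨L, hL⟩ : ∃ L, L = n + t + p + 1 := ⟨_, rfl⟩
  have hpass := passTime_le hL
  have hn : n ≤ L := by omega
  have h1 : 1 ≤ L := by omega
  have hW : p * (p + 3) + 1 ≤ 2 * L ^ 2 := by
    obtain ⟨M, rfl⟩ := Nat.exists_eq_add_of_le (show p + 1 ≤ L by omega)
    nlinarith
  have hp : p ≤ L := by omega
  have e1 : L ≤ L ^ 5 := Nat.le_self_pow (by norm_num) L
  have e2 : L ^ 2 ≤ L ^ 5 := Nat.pow_le_pow_right h1 (by norm_num)
  have e0 : 1 ≤ L ^ 5 := Nat.one_le_pow _ _ h1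
  have h2t : 1 ≤ 2 ^ t := Nat.one_le_two_pow
  have hrest : sieveTime n t p ≤ 2 ^ t * (1001 * L ^ 5) + 100 * L ^ 5 := by
    have : 2 ^ t * (passTime n t p (p * (p + 3) + 1) (p + 3) + 1) ≤ 2 ^ t * (1001 * L ^ 5) := by
      gcongr
      omega
    unfold sieveTime
    ring_nf at hW this ⊢
    linarith
  calc sieveTime n t p ≤ 2 ^ t * (1001 * L ^ 5) + 100 * L ^ 5 := hrest
    _ ≤ 2 ^ t * (1001 * L ^ 5) + 2 ^ t * (100 * L ^ 5) :=
      Nat.add_le_add_left (Nat.le_mul_of_pos_left _ (by positivity)) _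
    _ = 2 ^ t * (1101 * L ^ 5) := by ring
    _ ≤ 2 ^ (r + 1) * (1101 * L ^ 5) := by gcongr; norm_num
    _ = 2202 * L ^ 5 * 2 ^ r := by ring
    _ ≤ c * L ^ c * 2 ^ r := by gcongr; omega
    _ = timeBound c n t p r := by rw [timeBound, hL]

theorem evaluatorTime_le (n t p : ℕ) : evaluatorTime n t p ≤ sieveTime n t p := by
  unfold evaluatorTime sieveTime
  omega

end Time

/-! ### The probability of an error -/

section Probability

open Polynomial

variable {F : Type*} [Field F] {n t p k : ℕ}

/-- The exponents of a term of the sieved polynomial, in the variables of the elements and of the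
projected elements. -/
noncomputable def termExponent (m : Fin n →₀ ℕ) (J : Finset (Fin p)) : Fin (n + p) →₀ ℕ :=
  Finsupp.equivFunOnFinite.symm (Fin.append m fun j => if j ∈ J then 1 else 0)

theorem termExponent_injective :
    Function.Injective2 (termExponent : (Fin n →₀ ℕ) → Finset (Fin p) → _) := by
  intro m m' J J' h
  have h := Finsupp.equivFunOnFinite.symm.injective h
  constructor
  · ext i
    simpa using congrFun h (Fin.castAdd p i)
  · ext j
    have := congrFun h (Fin.natAdd n j)
    simp only [Fin.append_right] at this
    by_cases h1 : j ∈ J <;> by_cases h2 : j ∈ J' <;> simp_all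

/-- The polynomial whose values are `sieveValue`, in variables for the elements and the projected
elements. -/
noncomputable def projectedPolynomial (B : Matrix (Fin t) (Fin t) F) (E : Matrix (Fin t) (Fin p) F)
    (C' : Matrix (Fin t) (Fin n) F) (P : MvPolynomial (Fin n) F) :
    MvPolynomial (Fin (n + p)) F[X] :=
  ∑ m ∈ multilinearSupport P, ∑ J : Finset (Fin p),
    MvPolynomial.monomial (termExponent m J) (C (P.coeff m * termWeight B E C' J m))

theorem eval_projectedPolynomial (B : Matrix (Fin t) (Fin t) F) (E : Matrix (Fin t) (Fin p) F)
    (C' : Matrix (Fin t) (Fin n) F) (P : MvPolynomial (Fin n) F) (x : Fin n → F)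
    (z : Fin p → F[X]) :
    MvPolynomial.eval (Fin.append (fun i => C (x i)) z) (projectedPolynomial B E C' P) =
      sieveValue B E C' P x z := by
  rw [projectedPolynomial, sieveValue, Finset.sum_comm, map_sum]
  refine Finset.sum_congr rfl fun J _ => ?_
  rw [map_sum, map_sum, Finset.mul_sum]
  refine Finset.sum_congr rfl fun m hm => ?_
  rw [MvPolynomial.eval_monomial, Finsupp.prod_fintype _ _ (by simp), Fin.prod_univ_add]
  have h1 := prod_pow_eq_prod_support (mem_multilinearSupport.mp hm).2 x
  simp only [termExponent, Finsupp.equivFunOnFinite_symm_apply_apply, Fin.append_left,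
    Fin.append_right, ← map_pow, ← map_prod, h1, pow_ite, pow_one, pow_zero,
    Finset.prod_ite_mem, Finset.univ_inter, C_mul]
  ring

theorem coeff_projectedPolynomial (B : Matrix (Fin t) (Fin t) F) (E : Matrix (Fin t) (Fin p) F)
    (C' : Matrix (Fin t) (Fin n) F) (P : MvPolynomial (Fin n) F) {m : Fin n →₀ ℕ}
    (hm : m ∈ multilinearSupport P) (J : Finset (Fin p)) :
    (projectedPolynomial B E C' P).coeff (termExponent m J) =
      C (P.coeff m * termWeight B E C' J m) := by
  rw [projectedPolynomial, MvPolynomial.coeff_sum, Finset.sum_eq_single_of_mem m hm,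
    MvPolynomial.coeff_sum, Finset.sum_eq_single_of_mem J (Finset.mem_univ _),
    MvPolynomial.coeff_monomial, if_pos rfl]
  · intro J' _ hJ
    rw [MvPolynomial.coeff_monomial, if_neg fun h => hJ (termExponent_injective h).2]
  · intro m' _ hm
    rw [MvPolynomial.coeff_sum]
    refine Finset.sum_eq_zero fun J' _ => ?_
    rw [MvPolynomial.coeff_monomial, if_neg fun h => hm (termExponent_injective h).1]

theorem exists_of_mem_support {B : Matrix (Fin t) (Fin t) F} {E : Matrix (Fin t) (Fin p) F}
    {C' : Matrix (Fin t) (Fin n) F} {P : MvPolynomial (Fin n) F} {e : Fin (n + p) →₀ ℕ}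
    (he : e ∈ (projectedPolynomial B E C' P).support) :
    ∃ m ∈ multilinearSupport P, ∃ J, e = termExponent m J := by
  classical
  obtain ⟨m, hm, h⟩ := Finset.mem_biUnion.mp (MvPolynomial.support_sum he)
  obtain ⟨J, -, h⟩ := Finset.mem_biUnion.mp (MvPolynomial.support_sum h)
  exact ⟨m, hm, J, Finset.mem_singleton.mp (MvPolynomial.support_monomial_subset h)⟩

theorem digitPoly_injective (d : ℕ) :
    Function.Injective fun c : Fin d → F => ∑ v : Fin d, C (c v) * (X : F[X]) ^ (v : ℕ) := by
  intro c c' h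
  funext v
  have := congrArg (fun q : F[X] => q.coeff v) h
  simpa [finsetSum_coeff, coeff_C_mul, coeff_X_pow, Fin.val_inj] using this

/-- A polynomial of degree at most `k` in the first `n` variables and at most `1` in each of the
others vanishes with probability at most `k / q + p / q ^ d` if random elements of the field are
substituted for the former and random polynomials of degree less than `d` for the latter. -/
theorem card_zeros_le [Fintype F] [DecidableEq F] {d : ℕ} {Q : MvPolynomial (Fin (n + p)) F[X]}
    (hQ : Q ≠ 0)
    (hdeg : ∀ e ∈ Q.support, ∑ i : Fin n, e (Fin.castAdd p i) ≤ k ∧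
      ∀ j : Fin p, e (Fin.natAdd n j) ≤ 1) :
    ((Finset.univ.filter fun y : (Fin n → F) × (Fin p → Fin d → F) => MvPolynomial.eval
      (Fin.append (fun i => C (y.1 i)) fun j => ∑ v : Fin d, C (y.2 j v) * X ^ (v : ℕ)) Q = 0).card
        : ℚ≥0) ≤ (k / Fintype.card F + p / Fintype.card F ^ d) *
          Fintype.card ((Fin n → F) × (Fin p → Fin d → F)) := by
  classical
  let S : Fin (n + p) → Finset F[X] := Fin.append (fun _ => Finset.univ.image C)
    fun _ => Finset.univ.image fun c : Fin d → F => ∑ v : Fin d, C (c v) * X ^ (v : ℕ)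
  have hS1 : ∀ i, (S (Fin.castAdd p i)).card = Fintype.card F := by
    intro i
    simp only [S, Fin.append_left]
    rw [Finset.card_image_of_injective _ C_injective, Finset.card_univ]
  have hS2 : ∀ j, (S (Fin.natAdd n j)).card = Fintype.card F ^ d := by
    intro j
    simp only [S, Fin.append_right]
    rw [Finset.card_image_of_injective _ (digitPoly_injective d), Finset.card_univ,
      Fintype.card_fun, Fintype.card_fin]
  let β : (Fin n → F) × (Fin p → Fin d → F) → Fin (n + p) → F[X] := fun y =>
    Fin.append (fun i => C (y.1 i)) fun j => ∑ v : Fin d, C (y.2 j v) * X ^ (v : ℕ)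
  have hβ : Function.Injective β := by
    intro y y' h
    refine Prod.ext (funext fun i => ?_) (funext fun j => ?_)
    · have := congrFun h (Fin.castAdd p i)
      simp only [β, Fin.append_left] at this
      exact C_injective this
    · have := congrFun h (Fin.natAdd n j)
      simp only [β, Fin.append_right] at this
      exact digitPoly_injective d this
  have hcard : (∏ i, ((S i).card : ℚ≥0)) =
      Fintype.card ((Fin n → F) × (Fin p → Fin d → F)) := by
    rw [Fin.prod_univ_add]
    simp only [hS1, hS2]
    simp
  have hsz := MvPolynomial.schwartz_zippel_sup_sum hQ S
  rw [hcard] at hsz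
  have hsup : (Q.support.sup fun e => ∑ i, (e i / (S i).card : ℚ≥0)) ≤
      k / Fintype.card F + p / Fintype.card F ^ d := by
    refine Finset.sup_le fun e he => ?_
    rw [Fin.sum_univ_add]
    simp only [hS1, hS2, ← Finset.sum_div]
    obtain ⟨h1, h2⟩ := hdeg e he
    gcongr
    · exact_mod_cast h1
    · calc ∑ j : Fin p, (e (Fin.natAdd n j) : ℚ≥0) ≤ ∑ j : Fin p, 1 :=
          Finset.sum_le_sum fun j _ => by exact_mod_cast h2 j
        _ = p := by simp
    · simp
  have hpos : (0 : ℚ≥0) < Fintype.card ((Fin n → F) × (Fin p → Fin d → F)) := by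
    exact_mod_cast Fintype.card_pos
  have h := (div_le_iff₀ hpos).mp (hsz.trans hsup)
  refine le_trans ?_ h
  rw [Nat.cast_le, ← Finset.card_image_of_injective _ hβ]
  refine Finset.card_le_card fun pt hpt => ?_
  obtain ⟨y, hy, rfl⟩ := Finset.mem_image.mp hpt
  refine Finset.mem_filter.mpr ⟨Fintype.mem_piFinset.mpr fun i => ?_, (Finset.mem_filter.mp hy).2⟩
  refine Fin.addCases (fun i => ?_) (fun j => ?_) i
  · simp [S, β]
  · simp [S, β]

/-- A probability that depends only on an initial part of the tape. -/
theorem card_tapes_ge [Fintype F] {N d : ℕ} (hN : n + p * d ≤ N)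
    (G : (Fin n → F) → (Fin p → Fin d → F) → Prop)
    (hG : 2 / 3 * (Nat.card ((Fin n → F) × (Fin p → Fin d → F)) : ℝ) ≤
      Nat.card {y : (Fin n → F) × (Fin p → Fin d → F) // G y.1 y.2}) :
    2 / 3 * (Nat.card (Fin N → F) : ℝ) ≤ Nat.card {w : Fin N → F //
      G (fun i => padTape w i) (fun j v => padTape w (j * d + v + n))} := by
  classical
  obtain ⟨r, rfl⟩ := Nat.exists_eq_add_of_le hN
  let idx : (Fin n ⊕ (Fin p × Fin d)) ⊕ Fin r ≃ Fin (n + p * d + r) :=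
    (Equiv.sumCongr ((Equiv.sumCongr (Equiv.refl _) finProdFinEquiv).trans finSumFinEquiv)
      (Equiv.refl _)).trans finSumFinEquiv
  let Φ : (Fin (n + p * d + r) → F) ≃ ((Fin n → F) × (Fin p → Fin d → F)) × (Fin r → F) :=
    (idx.symm.arrowCongr (Equiv.refl F)).trans ((Equiv.sumArrowEquivProdArrow _ _ _).trans
      (Equiv.prodCongr ((Equiv.sumArrowEquivProdArrow _ _ _).trans
        (Equiv.prodCongr (Equiv.refl _) (Equiv.curry _ _ _))) (Equiv.refl _)))
  have h1 : ∀ w, (Φ w).1.1 = fun i : Fin n => padTape w i := by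
    intro w
    funext i
    have : (i : ℕ) < n + p * d + r := by omega
    rw [padTape, dif_pos this]
    rfl
  have h2 : ∀ w, (Φ w).1.2 = fun (j : Fin p) (v : Fin d) => padTape w (j * d + v + n) := by
    intro w
    funext j v
    have : (j : ℕ) * d + v + n < n + p * d + r := by
      have hj : (j + 1) * d ≤ p * d := Nat.mul_le_mul_right d j.2
      have hv := v.2
      rw [Nat.add_mul] at hj
      omega
    rw [padTape, dif_pos this]
    refine congrArg w (Fin.ext ?_)
    simp [idx]
    ring
  have e1 : {w : Fin (n + p * d + r) → F //
      G (fun i => padTape w i) (fun j v => padTape w (j * d + v + n))} ≃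
      {y : (Fin n → F) × (Fin p → Fin d → F) // G y.1 y.2} × (Fin r → F) :=
    (Φ.subtypeEquiv (q := fun y => G y.1.1 y.1.2) fun w => by rw [h1, h2]).trans
      (Equiv.prodSubtypeFstEquivSubtypeProd (p := fun y : (Fin n → F) × (Fin p → Fin d → F) =>
        G y.1 y.2))
  rw [Nat.card_congr e1, Nat.card_congr Φ, Nat.card_prod, Nat.card_prod _ (Fin r → F)]
  push_cast
  rw [← mul_assoc]
  exact mul_le_mul_of_nonneg_right hG (Nat.cast_nonneg _)

end Probability

/-! ### The two algorithms -/

section Final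

open Polynomial

variable {F : Type*} [Field F] [CharP F 2] {n t p k : ℕ}

theorem isFeasibleTerm_iff {D : DeltaMatroid (Fin n)} {B : Matrix (Fin t) (Fin t) F}
    {E : Matrix (Fin t) (Fin p) F} {C' : Matrix (Fin t) (Fin n) F}
    (h : IsProjectedSparseRep D B E C') (P : MvPolynomial (Fin n) F) (m : Fin n →₀ ℕ) :
    IsFeasibleTerm D P m ↔
      m ∈ multilinearSupport P ∧ ∃ J, P.coeff m * termWeight B E C' J m ≠ 0 := by
  rw [IsFeasibleTerm, mem_multilinearSupport, h.2]
  constructor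
  · rintro ⟨h1, h2, J, h3⟩
    exact ⟨⟨h1, h2⟩, J, mul_ne_zero h1 ((termWeight_ne_zero_iff h.1 E C' J m).mpr h3)⟩
  · rintro ⟨⟨h1, h2⟩, J, h3⟩
    exact ⟨h1, h2, J, (termWeight_ne_zero_iff h.1 E C' J m).mp (right_ne_zero_of_mul h3)⟩

theorem coeff_sievedPolynomial_ne_zero_iff {D : DeltaMatroid (Fin n)}
    {B : Matrix (Fin t) (Fin t) F} {C' : Matrix (Fin t) (Fin n) F} (h : IsSparseRep D B C')
    (P : MvPolynomial (Fin n) F) (m : Fin n →₀ ℕ) :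
    (sievedPolynomial B C' P).coeff m ≠ 0 ↔ IsFeasibleTerm D P m := by
  have hf : m.support ∈ D.Feasible ↔
      pfaffianOn (sparseMatrix B C') (Finset.univ.disjSum m.support) ≠ 0 := by
    rw [h.2, pfaffianOn_eq_coverSum, ← disjSum_mem_nonsingularSets h.1]
    rfl
  rw [IsFeasibleTerm, hf, ← and_assoc, ← mem_multilinearSupport, sievedPolynomial_eq_sum,
    MvPolynomial.coeff_sum]
  simp only [MvPolynomial.coeff_monomial, Finset.sum_ite_eq']
  constructor
  · intro h'
    have hm : m ∈ multilinearSupport P := by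
      by_contra hm
      exact h' (if_neg hm)
    rw [if_pos hm] at h'
    exact ⟨hm, right_ne_zero_of_mul h'⟩
  · rintro ⟨hm, h'⟩
    rw [if_pos hm]
    exact mul_ne_zero (mem_multilinearSupport.mp hm).1 h'

/-- A power of two is not a multiple of three, which leaves room for the error from the random
polynomials. -/
theorem error_le [Finite F] (hk : 3 * k ≤ Nat.card F) :
    (k / Nat.card F + p / Nat.card F ^ (p + 3) : ℚ≥0) ≤ 1 / 3 := by
  have := Fintype.ofFinite F
  obtain ⟨e, -, he⟩ := FiniteField.card F 2
  rw [← Nat.card_eq_fintype_card] at he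
  have h2 : 2 ≤ Nat.card F := by
    rw [he]; exact Nat.le_self_pow e.ne_zero 2
  have hne : 3 * k ≠ Nat.card F := by
    intro h
    have h3 : 3 ∣ 2 ^ (e : ℕ) := ⟨k, by rw [← he, h]⟩
    exact absurd (Nat.prime_three.dvd_of_dvd_pow h3) (by norm_num)
  obtain ⟨q, hq⟩ : ∃ q, q = Nat.card F := ⟨_, rfl⟩
  rw [← hq] at hk h2 hne ⊢
  have hp : 3 * p ≤ q ^ (p + 2) := by
    have h1 : p < 2 ^ p := Nat.lt_two_pow_self
    have h3 : 2 ^ (p + 2) ≤ q ^ (p + 2) := Nat.pow_le_pow_left h2 _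
    rw [pow_add] at h3
    omega
  have hnat : 3 * (k * q ^ (p + 2) + p) ≤ q ^ (p + 3) := by
    have h1 : (3 * k + 1) * q ^ (p + 2) ≤ q * q ^ (p + 2) := Nat.mul_le_mul_right _ (by omega)
    rw [← pow_succ'] at h1
    nlinarith
  have hq0 : (0 : ℚ≥0) < q := by exact_mod_cast (by omega : 0 < q)
  have e1 : (k / q + p / q ^ (p + 3) : ℚ≥0) = (k * q ^ (p + 2) + p) / q ^ (p + 3) := by
    rw [add_div, pow_succ (q : ℚ≥0) (p + 2), mul_comm ((q : ℚ≥0) ^ (p + 2)) q,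
      mul_div_mul_right _ _ (by positivity)]
  rw [e1, div_le_div_iff₀ (by positivity) (by norm_num), one_mul, mul_comm]
  exact_mod_cast hnat

theorem card_sieveValue_ne_zero_ge [Finite F] {D : DeltaMatroid (Fin n)}
    {B : Matrix (Fin t) (Fin t) F} {E : Matrix (Fin t) (Fin p) F} {C' : Matrix (Fin t) (Fin n) F}
    (h : IsProjectedSparseRep D B E C') {P : MvPolynomial (Fin n) F} (hP : P.IsHomogeneous k)
    (hk : 3 * k ≤ Nat.card F) (hm : ∃ m, IsFeasibleTerm D P m) :
    2 / 3 * (Nat.card ((Fin n → F) × (Fin p → Fin (p + 3) → F)) : ℝ) ≤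
      Nat.card {y : (Fin n → F) × (Fin p → Fin (p + 3) → F) // sieveValue B E C' P y.1
        (fun j => ∑ v : Fin (p + 3), C (y.2 j v) * X ^ (v : ℕ)) ≠ 0} := by
  classical
  have := Fintype.ofFinite F
  obtain ⟨m, hm⟩ := hm
  obtain ⟨hm, J, hJ⟩ := (isFeasibleTerm_iff h P m).mp hm
  have hQ : projectedPolynomial B E C' P ≠ 0 := by
    intro h0
    have hc := coeff_projectedPolynomial B E C' P hm J
    rw [h0, MvPolynomial.coeff_zero] at hc
    exact hJ (C_eq_zero.mp hc.symm)
  have hbad := card_zeros_le (k := k) (d := p + 3) hQ (by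
    intro e he
    obtain ⟨m, hm, J, rfl⟩ := exists_of_mem_support he
    have hdeg := hP (mem_multilinearSupport.mp hm).1
    rw [Finsupp.weight_apply, Finsupp.sum_fintype _ _ (by simp)] at hdeg
    constructor
    · refine le_of_eq ?_
      simpa [termExponent] using hdeg
    · intro j
      simp only [termExponent, Finsupp.equivFunOnFinite_symm_apply_apply, Fin.append_right]
      split_ifs <;> omega)
  simp only [eval_projectedPolynomial] at hbad
  rw [← Nat.card_eq_fintype_card] at hbad
  have hbad := hbad.trans (mul_le_mul_of_nonneg_right (error_le hk) zero_le)
  rw [← Nat.card_eq_fintype_card] at hbad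
  have hsplit := Finset.card_filter_add_card_filter_not (s := Finset.univ)
    (fun y : (Fin n → F) × (Fin p → Fin (p + 3) → F) => sieveValue B E C' P y.1
        (fun j => ∑ v : Fin (p + 3), C (y.2 j v) * X ^ (v : ℕ)) = 0)
  rw [Finset.card_univ, ← Nat.card_eq_fintype_card] at hsplit
  rw [Nat.card_eq_fintype_card (α := {y : (Fin n → F) × (Fin p → Fin (p + 3) → F) // _}),
    Fintype.card_subtype]
  rw [← hsplit] at hbad ⊢
  simp only [ne_eq]
  generalize (Finset.univ.filter fun y : (Fin n → F) × (Fin p → Fin (p + 3) → F) =>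
    sieveValue B E C' P y.1
        (fun j => ∑ v : Fin (p + 3), C (y.2 j v) * X ^ (v : ℕ)) = 0).card = b at hbad ⊢
  generalize (Finset.univ.filter fun y : (Fin n → F) × (Fin p → Fin (p + 3) → F) =>
    ¬ sieveValue B E C' P y.1
        (fun j => ∑ v : Fin (p + 3), C (y.2 j v) * X ^ (v : ℕ)) = 0).card = g at hbad ⊢
  have h3 : 3 * b ≤ b + g := by
    have h4 : (3 * b : ℚ≥0) ≤ b + g := by
      calc (3 * b : ℚ≥0) ≤ 3 * (1 / 3 * ((b + g : ℕ) : ℚ≥0)) := by gcongr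
        _ = b + g := by push_cast; rw [← mul_assoc]; norm_num
    exact_mod_cast h4
  have h3 : (3 * b : ℝ) ≤ b + g := by exact_mod_cast h3
  push_cast
  linarith

/-- Without a feasible term the sieve never errs, since all weights vanish. -/
theorem sieveValue_eq_zero {D : DeltaMatroid (Fin n)}
    {B : Matrix (Fin t) (Fin t) F} {E : Matrix (Fin t) (Fin p) F} {C' : Matrix (Fin t) (Fin n) F}
    (h : IsProjectedSparseRep D B E C') {P : MvPolynomial (Fin n) F}
    (hm : ¬ ∃ m, IsFeasibleTerm D P m) (x : Fin n → F) (z : Fin p → F[X]) :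
    sieveValue B E C' P x z = 0 := by
  refine Finset.sum_eq_zero fun J _ => ?_
  rw [Finset.sum_eq_zero, map_zero, mul_zero]
  intro m hm'
  by_contra hne
  exact hm ⟨m, (isFeasibleTerm_iff h P m).mpr ⟨hm', J, left_ne_zero_of_mul hne⟩⟩

theorem reads_le_sieveTime (n t p : ℕ) : n + p * (p + 3) ≤ sieveTime n t p := by
  unfold sieveTime
  have h : p * (((p + 3) * (1 + 2) + 2) + 2) = p * (p + 3) * 3 + p * 4 := by ring
  rw [h]
  omega

theorem yesProb_sieve_ge [Finite F] {D : DeltaMatroid (Fin n)}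
    {B : Matrix (Fin t) (Fin t) F} {E : Matrix (Fin t) (Fin p) F} {C' : Matrix (Fin t) (Fin n) F}
    (h : IsProjectedSparseRep D B E C') {N : ℕ} (hN : sieveTime n t p ≤ N) {P : MvPolynomial (Fin n) F}
    (hP : P.IsHomogeneous k) (hk : 3 * k ≤ Nat.card F) (hm : ∃ m, IsFeasibleTerm D P m) :
    2 / 3 ≤ yesProb (blackBox P) .sieve (inputStore k B E C' 0) N := by
  have := Fintype.ofFinite F
  have hcard := card_tapes_ge ((reads_le_sieveTime n t p).trans hN)
    (fun x c => sieveValue B E C' P x (fun j => ∑ v : Fin (p + 3), C (c j v) * X ^ (v : ℕ)) ≠ 0)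
    (card_sieveValue_ne_zero_ge h hP hk hm)
  rw [yesProb, le_div_iff₀ (by exact_mod_cast Nat.card_pos)]
  refine hcard.trans (Nat.cast_le.mpr ?_)
  refine Nat.card_le_card_of_injective (fun w => ⟨w.1, ?_⟩) fun w w' hw =>
    Subtype.ext (congrArg (fun w => w.1) hw)
  refine (sieve_spec B E C' hP (padTape w.1) rfl).mono hN fun s' hs' => hs'.1 ?_
  have hd : ∀ c : ℕ → F, digitPoly (p + 3) c = ∑ v : Fin (p + 3), C (c v) * X ^ (v : ℕ) :=
    fun c => Finset.sum_range _
  simp only [hd]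
  exact w.2

end Final

theorem theorem1p4 :
    ∃ (c : ℕ) (evaluator sieve : Prog),
      -- Linear delta-matroids: the sieved polynomial and its evaluation.
      (∀ (F : Type*) [Field F] [CharP F 2] (n t k : ℕ)
        (D : DeltaMatroid (Fin n))
        (B : Matrix (Fin t) (Fin t) F) (C : Matrix (Fin t) (Fin n) F)
        (P : MvPolynomial (Fin n) F),
        IsSparseRep D B C → t ≤ D.rank + 1 → P.IsHomogeneous k →
          (∀ m, (sievedPolynomial B C P).coeff m ≠ 0 ↔ IsFeasibleTerm D P m) ∧
          (∀ (x : Fin n → F) (tape : ℕ → F),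
            HaltsWithin (blackBox P) evaluator
              (inputStore k B (0 : Matrix (Fin t) (Fin 0) F) C x tape)
              (timeBound c n t 0 D.rank)
              (fun s => s.outF = MvPolynomial.eval x (sievedPolynomial B C P)))) ∧
      -- Projected linear delta-matroids: randomized sieving with one-sided error.
      (∀ (F : Type*) [Field F] [Finite F] [CharP F 2] (n t p k : ℕ)
        (D : DeltaMatroid (Fin n))
        (B : Matrix (Fin t) (Fin t) F) (E : Matrix (Fin t) (Fin p) F)
        (C : Matrix (Fin t) (Fin n) F) (P : MvPolynomial (Fin n) F),
        IsProjectedSparseRep D B E C → t ≤ D.rank + 1 → P.IsHomogeneous k →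
        3 * k ≤ Nat.card F →
          (∀ tape : ℕ → F,
            HaltsWithin (blackBox P) sieve (inputStore k B E C 0 tape)
              (timeBound c n t p D.rank)
              (fun s => s.outI = 1 ∨ s.outI = 0)) ∧
          ((¬ ∃ m, IsFeasibleTerm D P m) → ∀ tape : ℕ → F,
            HaltsWithin (blackBox P) sieve (inputStore k B E C 0 tape)
              (timeBound c n t p D.rank) (fun s => s.outI = 0)) ∧
          ((∃ m, IsFeasibleTerm D P m) →
            2 / 3 ≤ yesProb (blackBox P) sieve (inputStore k B E C 0)
              (timeBound c n t p D.rank))) := by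
  refine ⟨2202, .evaluator, .sieve, ?_, ?_⟩
  · intro F _ _ n t k D B C P hD ht hP
    refine ⟨coeff_sievedPolynomial_ne_zero_iff hD P, fun x tape => ?_⟩
    exact (evaluator_spec B C hP x tape).mono
      ((evaluatorTime_le n t 0).trans (sieveTime_le_timeBound le_rfl ht)) fun _ h => h
  · intro F _ _ _ n t p k D B E C P hD ht hP hk
    refine ⟨fun tape => ?_, fun hm tape => ?_,
      yesProb_sieve_ge hD (sieveTime_le_timeBound le_rfl ht) hP hk⟩
    · refine (sieve_spec B E C hP tape rfl).mono (sieveTime_le_timeBound le_rfl ht) fun s hs => ?_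
      rcases eq_or_ne (sieveValue B E C P (fun i => tape i) fun j =>
        digitPoly (p + 3) fun v => tape (j * (p + 3) + v + n)) 0 with h | h
      · exact Or.inr (hs.2 h)
      · exact Or.inl (hs.1 h)
    · exact (sieve_spec B E C hP tape rfl).mono (sieveTime_le_timeBound le_rfl ht) fun s hs =>
        hs.2 (sieveValue_eq_zero hD hm _ _)
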